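/- Let $M$ be a finite simplicial complex whose geometric realization is a closed topological $n$-manifold ($n \ge 1$; $M$ need not be connected). Let $\mathrm{Vol}(M)$ be the number of $n$-simplices of $M$, and let $\mathrm{sys}_k(M)$ be the minimal number of $k$-simplices in a simplicial $k$-cycle with coefficients in $\mathbb{Z}/2$ that represents a nonzero class of $H_k(M;\mathbb{Z}/2)$ (with $\mathrm{sys}_k(M)=\infty$ if $H_k(M;\mathbb{Z}/2)=0$). Theorem. For every $n \ge 1$ and every $\varepsilon > 0$ there is a constant $c = c(n,\varepsilon) > 0$ such that every such $M$ with $H^1(M;\mathbb{Z}/2) \neq 0$ satisfies $$\mathrm{sys}_1(M)\cdot \mathrm{sys}_{n-1}(M) \le c\,\mathrm{Vol}(M)^{1+\varepsilon}.$$ In particular, both systoles are finite. -/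

import Mathlib

open scoped ENNReal

noncomputable section

namespace AbstractSimplicialComplex

variable {V : Type*} [Fintype V] (K : AbstractSimplicialComplex V)

/-- The geometric realization of a finite simplicial complex with vertex set `V`, in barycentric
coordinates: the points of the standard simplex on `V` that are supported in a face of `K`. -/
def realization : Set (V → ℝ) :=
  {x | x ∈ stdSimplex ℝ V ∧ ∃ s ∈ K, ∀ v, x v ≠ 0 → v ∈ s}

/-- The realization of `K` is a closed topological `n`-manifold, i.e. it is locally homeomorphic to
`ℝⁿ`. (It is compact, Hausdorff and second countable in any case, because `V` is finite.) -/
def IsClosedManifold (n : ℕ) : Prop :=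
  Nonempty (ChartedSpace (EuclideanSpace ℝ (Fin n)) K.realization)

/-- The `k`-simplices of `K`: the faces with `k + 1` vertices. -/
def Simplices (k : ℕ) : Type _ := {s : Finset V // s ∈ K ∧ s.card = k + 1}

instance (k : ℕ) : Finite (K.Simplices k) :=
  inferInstanceAs (Finite {s : Finset V // s ∈ K ∧ s.card = k + 1})

instance (k : ℕ) : Fintype (K.Simplices k) := Fintype.ofFinite _

/-- The volume in dimension `n`: the number of `n`-simplices. -/
def vol (n : ℕ) : ℕ := Fintype.card (K.Simplices n)

/-- The simplicial `k`-chains with coefficients in `ℤ/2`. These are also the simplicial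
`k`-cochains with coefficients in `ℤ/2`. -/
abbrev Chain (k : ℕ) : Type _ := K.Simplices k → ZMod 2

open Classical in
/-- The incidence matrix between `k`-simplices and `(k + 1)`-simplices. -/
def incidence (k : ℕ) : Matrix (K.Simplices k) (K.Simplices (k + 1)) (ZMod 2) :=
  Matrix.of fun τ σ => if τ.1 ⊆ σ.1 then 1 else 0

/-- The boundary map mod 2 from `(k + 1)`-chains to `k`-chains: the boundary of a simplex is the
sum of its facets. -/
def boundary (k : ℕ) : K.Chain (k + 1) →ₗ[ZMod 2] K.Chain k :=
  (K.incidence k).mulVecLin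

/-- The coboundary map mod 2 from `k`-cochains to `(k + 1)`-cochains: its value on a simplex is the
sum of the values on the facets. -/
def coboundary (k : ℕ) : K.Chain k →ₗ[ZMod 2] K.Chain (k + 1) :=
  (K.incidence k).transpose.mulVecLin

/-- The mod 2 simplicial `k`-cycles (every `0`-chain is a cycle). -/
def cycles : (k : ℕ) → Submodule (ZMod 2) (K.Chain k)
  | 0 => ⊤
  | k + 1 => LinearMap.ker (K.boundary k)

/-- The mod 2 simplicial `k`-boundaries. -/
def boundaries (k : ℕ) : Submodule (ZMod 2) (K.Chain k) := LinearMap.range (K.boundary k)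

/-- The simplicial homology `H_k(K; ℤ/2)`: cycles modulo boundaries. -/
abbrev Homology (k : ℕ) : Type _ := K.cycles k ⧸ (K.boundaries k).submoduleOf (K.cycles k)

/-- The homology class represented by a cycle. -/
def homologyClass (k : ℕ) : K.cycles k →ₗ[ZMod 2] K.Homology k :=
  ((K.boundaries k).submoduleOf (K.cycles k)).mkQ

/-- The mod 2 simplicial `k`-cocycles. -/
def cocycles (k : ℕ) : Submodule (ZMod 2) (K.Chain k) := LinearMap.ker (K.coboundary k)

/-- The mod 2 simplicial `k`-coboundaries. -/
def coboundaries : (k : ℕ) → Submodule (ZMod 2) (K.Chain k)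
  | 0 => ⊥
  | k + 1 => LinearMap.range (K.coboundary k)

/-- The simplicial cohomology `H^k(K; ℤ/2)`: cocycles modulo coboundaries. -/
abbrev Cohomology (k : ℕ) : Type _ :=
  K.cocycles k ⧸ (K.coboundaries k).submoduleOf (K.cocycles k)

/-- The number of `k`-simplices in a mod 2 chain. -/
def size {k : ℕ} (z : K.Chain k) : ℕ := (Function.support z).ncard

/-- The `k`-dimensional mod 2 systole: the least number of `k`-simplices in a simplicial `k`-cycle
representing a nonzero class of `H_k(K; ℤ/2)`. It is `⊤` if `H_k(K; ℤ/2) = 0`. -/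
def systole (k : ℕ) : ℕ∞ :=
  ⨅ (z : K.cycles k) (_ : K.homologyClass k z ≠ 0), (K.size (z : K.Chain k) : ℕ∞)

end AbstractSimplicialComplex

end

/-! ### Brouwer's fixed point theorem by the volume-polynomial argument. -/

section Brouwer

open Set Metric MeasureTheory Filter Topology Polynomial

variable {n : ℕ}

local notation "𝔼" => EuclideanSpace ℝ (Fin n)

/-! Let `α` be a 1-cocycle that is not a coboundary. Choose a base vertex in every `n`-simplex and
every `(n - 1)`-simplex. An `(n - 1)`-simplex `τ` between two `n`-simplices `σ`, `σ'` belongs to the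
Poincaré dual chain of `α` when `α` takes the value 1 on the path `base σ`, `base τ`, `base σ'`.
This chain is a cycle with nonzero homology class, and it stays so after adding the boundary of any
`n`-chain `c` (`homologyClass_dualChain_ne_zero`). So `sys_{n-1}` is bounded by the size of
`dualChain α c`, and `c` is free to make that small.

If `sys_1 > 4L + 2`, then `α` vanishes on all loops inside a dual-graph ball of radius `L`.
Integrating `α` along paths from the centre gives a `c` that kills the dual chain inside that ball
(`exists_potential_of_near`). Carve the whole dual graph into pieces of radius at most `L` with few
cut edges: a ball whose boundary is always large grows exponentially, so cutting at most `θ Vol`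
edges is possible as soon as `Vol < (1 + θ/(n+1))^L` (`exists_potential_ncard_le`). Only cut edges
survive in the dual chain. With `θ` of order `log Vol / L` and `L` of order `sys_1` this gives
`sys_1 * sys_{n-1} = O(Vol log Vol)`. If `sys_1 = O(log Vol)`, counting all `(n - 1)`-simplices is
enough.

Three facts about triangulated manifolds are needed: purity, exactly two cofaces in codimension 1,
and strong connectivity of vertex stars. They are derived here from locally Euclidean charts alone.
Invariance of domain gives the first two; the third follows because a set of codimension two does
not separate a ball. Both tools rest on Brouwer's theorem. -/

theorem det_one_add_pos_of_norm_lt_one {E : Type*} [NormedAddCommGroup E] [NormedSpace ℝ E]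
    [FiniteDimensional ℝ E] (A : E →L[ℝ] E) (hA : ‖A‖ < 1) :
    0 < (ContinuousLinearMap.id ℝ E + A).det := by
  have : CompleteSpace E := FiniteDimensional.complete ℝ E
  by_contra! hneg
  have hcont : Continuous fun s : ℝ => (ContinuousLinearMap.id ℝ E + s • A).det :=
    ContinuousLinearMap.continuous_det.comp (by fun_prop)
  have h0 : (0 : ℝ) ∈ Icc ((ContinuousLinearMap.id ℝ E + (1 : ℝ) • A).det)
      ((ContinuousLinearMap.id ℝ E + (0 : ℝ) • A).det) := by
    constructor
    · simpa using hneg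
    · simp [ContinuousLinearMap.det]
  -- The determinant is 1 at `s = 0`, and `id + s • A` is invertible for all `s` in `[0, 1]` by the
  -- Neumann series, so it cannot cross zero.
  obtain ⟨s, hs, hs0⟩ := intermediate_value_Icc' (zero_le_one' ℝ) hcont.continuousOn h0
  have hsA : ‖-(s • A)‖ < 1 := by
    rw [norm_neg, norm_smul, Real.norm_of_nonneg hs.1]
    nlinarith [norm_nonneg A, hs.2, hs.1]
  have hu : IsUnit (ContinuousLinearMap.id ℝ E + s • A) := by
    have := (Units.oneSub (-(s • A)) hsA).isUnit
    rw [Units.val_oneSub, sub_neg_eq_add] at this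
    exact this
  have hu' : IsUnit ((ContinuousLinearMap.id ℝ E + s • A : E →L[ℝ] E) : E →ₗ[ℝ] E) :=
    hu.map (ContinuousLinearMap.toLinearMapRingHom : (E →L[ℝ] E) →+* (E →ₗ[ℝ] E))
  exact (LinearMap.isUnit_iff_isUnit_det _).1 hu' |>.ne_zero hs0

theorem exists_polynomial_det_one_add_smul (A : 𝔼 →L[ℝ] 𝔼) :
    ∃ P : ℝ[X], P.natDegree ≤ n ∧
      ∀ t : ℝ, P.eval t = (ContinuousLinearMap.id ℝ 𝔼 + t • A).det := by
  let b := (EuclideanSpace.basisFun (Fin n) ℝ).toBasis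
  let N := LinearMap.toMatrix b b (A : 𝔼 →ₗ[ℝ] 𝔼)
  refine ⟨Matrix.det ((X : ℝ[X]) • N.map C + (1 : Matrix (Fin n) (Fin n) ℝ).map C), ?_, ?_⟩
  · simpa using natDegree_det_X_add_C_le N 1
  · intro t
    rw [← coe_evalRingHom, RingHom.map_det, ContinuousLinearMap.det, ← LinearMap.det_toMatrix b]
    congr 1
    ext i j
    by_cases h : i = j <;>
      simp [N, LinearMap.toMatrix_apply, b, h, add_comm, mul_comm t]

/-- For `t * K < 1` the map is a small Lipschitz perturbation of the identity, hence a bijection of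
the space. It fixes every point outside the ball, so the ball must go onto itself. -/
theorem image_closedBall_of_perturbation {u : 𝔼 → 𝔼} {R : ℝ} {K : NNReal}
    (hu : LipschitzWith K u) (hu0 : ∀ x, R < ‖x‖ → u x = 0) {t : ℝ} (ht : 0 ≤ t)
    (htK : t * K < 1) :
    Function.Injective (fun x => x + t • u x) ∧
      (fun x => x + t • u x) '' closedBall 0 R = closedBall 0 R := by
  set f : 𝔼 → 𝔼 := fun x => x + t • u x
  have happ : ApproximatesLinearOn f ((ContinuousLinearEquiv.refl ℝ 𝔼 : 𝔼 ≃L[ℝ] 𝔼) : 𝔼 →L[ℝ] 𝔼)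
      univ (t.toNNReal * K) := by
    intro x _ y _
    have : f x - f y - ((ContinuousLinearEquiv.refl ℝ 𝔼 : 𝔼 ≃L[ℝ] 𝔼) : 𝔼 →L[ℝ] 𝔼) (x - y)
        = t • (u x - u y) := by
      simp only [f, ContinuousLinearEquiv.coe_refl, ContinuousLinearMap.id_apply, smul_sub]
      abel
    rw [this, norm_smul, Real.norm_of_nonneg ht, NNReal.coe_mul, Real.coe_toNNReal _ ht, mul_assoc]
    gcongr
    simpa [dist_eq_norm] using hu.dist_le_mul x y
  have hc : Subsingleton 𝔼 ∨ t.toNNReal * K <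
      ‖((ContinuousLinearEquiv.refl ℝ 𝔼).symm : 𝔼 →L[ℝ] 𝔼)‖₊⁻¹ := by
    rcases subsingleton_or_nontrivial 𝔼 with h | h
    · exact Or.inl h
    · right
      have : ‖((ContinuousLinearEquiv.refl ℝ 𝔼).symm : 𝔼 →L[ℝ] 𝔼)‖₊ = 1 := by
        rw [← NNReal.coe_inj]
        simp
      rw [this, inv_one, ← NNReal.coe_lt_coe]
      simpa [Real.coe_toNNReal _ ht] using htK
  have hinj : Function.Injective f := injOn_univ.1 (happ.injOn hc)
  have hsurj : Function.Surjective f := happ.surjective hc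
  have hfix : ∀ x, R < ‖x‖ → f x = x := fun x hx => by simp [f, hu0 x hx]
  refine ⟨hinj, subset_antisymm ?_ ?_⟩
  · rintro _ ⟨x, hx, rfl⟩
    rw [mem_closedBall_zero_iff] at hx ⊢
    by_contra! h
    have := hinj (hfix _ h)
    rw [this] at h
    exact absurd hx h.not_ge
  · intro y hy
    obtain ⟨x, rfl⟩ := hsurj y
    refine ⟨x, ?_, rfl⟩
    rw [mem_closedBall_zero_iff] at hy ⊢
    by_contra! h
    rw [hfix x h] at hy
    exact absurd hy h.not_ge

/-- With `u` replaced by `t • u`, the integrand is a polynomial in `t` at each point. For small `t`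
the change of variables formula shows that the integral is independent of `t`, and a polynomial that
is constant on an interval is constant, so the value at `t = 1` is the same. -/
theorem integral_perturbation_eq {u : 𝔼 → 𝔼} (hu : ContDiff ℝ 1 u) {R : ℝ}
    (hu0 : ∀ x, R < ‖x‖ → u x = 0) (c : ℝ) (k : ℕ) :
    ∫ x in closedBall (0 : 𝔼) R, (ContinuousLinearMap.id ℝ 𝔼 + fderiv ℝ u x).det *
      (c - ‖x + u x‖ ^ 2) ^ k = ∫ x in closedBall (0 : 𝔼) R, (c - ‖x‖ ^ 2) ^ k := by
  have hcs : HasCompactSupport u := HasCompactSupport.intro (isCompact_closedBall (0 : 𝔼) R)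
    fun x hx => hu0 x (by simpa using hx)
  obtain ⟨K, hK⟩ := hu.lipschitzWith_of_hasCompactSupport hcs one_ne_zero
  set F : ℝ → 𝔼 → ℝ := fun t x => (ContinuousLinearMap.id ℝ 𝔼 + t • fderiv ℝ u x).det *
      (c - ‖x + t • u x‖ ^ 2) ^ k with hF
  have hfd : Continuous (fderiv ℝ u) := hu.continuous_fderiv one_ne_zero
  have hFc : ∀ t, Continuous (F t) := fun t => by
    have h1 : Continuous fun x => (ContinuousLinearMap.id ℝ 𝔼 + t • fderiv ℝ u x).det :=
      ContinuousLinearMap.continuous_det.comp (by fun_prop)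
    have h2 := hu.continuous
    exact h1.mul (by fun_prop)
  have hFi : ∀ t, IntegrableOn (F t) (closedBall (0 : 𝔼) R) := fun t =>
    (hFc t).continuousOn.integrableOn_compact (isCompact_closedBall _ _)
  have hpoly : ∀ x, ∃ P : ℝ[X], P.natDegree ≤ n + 2 * k ∧ ∀ t, P.eval t = F t x := by
    intro x
    obtain ⟨P, hP, hPe⟩ := exists_polynomial_det_one_add_smul (fderiv ℝ u x)
    refine ⟨P * (C c - (C (‖x‖ ^ 2) + C (2 * inner ℝ x (u x)) * X + C (‖u x‖ ^ 2) * X ^ 2)) ^ k,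
      ?_, fun t => ?_⟩
    · refine natDegree_mul_le.trans (add_le_add hP (natDegree_pow_le.trans ?_))
      rw [mul_comm 2 k]
      refine Nat.mul_le_mul_left _ ?_
      compute_degree
    · simp only [hF, eval_mul, hPe, eval_pow, eval_sub, eval_add, eval_C, eval_X]
      congr 2
      rw [norm_add_sq_real, inner_smul_right, norm_smul, mul_pow, Real.norm_eq_abs, sq_abs]
      ring
  set I : ℝ → ℝ := fun t => ∫ x in closedBall (0 : 𝔼) R, F t x with hI
  have hsmall : ∀ t : ℝ, 0 ≤ t → t * K < 1 →
      I t = ∫ x in closedBall (0 : 𝔼) R, (c - ‖x‖ ^ 2) ^ k := by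
    intro t ht htK
    obtain ⟨hinj, himg⟩ := image_closedBall_of_perturbation hK hu0 ht htK
    have hder : ∀ x ∈ closedBall (0 : 𝔼) R, HasFDerivWithinAt (fun x => x + t • u x)
        (ContinuousLinearMap.id ℝ 𝔼 + t • fderiv ℝ u x) (closedBall 0 R) x := fun x _ =>
      ((hasFDerivAt_id x).add
        (((hu.differentiable one_ne_zero x).hasFDerivAt).const_smul t)).hasFDerivWithinAt
    have := integral_image_eq_integral_abs_det_fderiv_smul (volume : Measure 𝔼)
      measurableSet_closedBall hder hinj.injOn (fun y => (c - ‖y‖ ^ 2) ^ k)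
    rw [himg] at this
    rw [this]
    refine integral_congr_ae (Eventually.of_forall fun x => ?_)
    have hpos := det_one_add_pos_of_norm_lt_one (t • fderiv ℝ u x) (by
      rw [norm_smul, Real.norm_of_nonneg ht]
      exact (mul_le_mul_of_nonneg_left (norm_fderiv_le_of_lipschitz ℝ hK) ht).trans_lt htK)
    simp only [hF, abs_of_pos hpos, smul_eq_mul]
  set N := n + 2 * k
  -- `N + 1` distinct nodes in the range where `t * K < 1`. Lagrange interpolation at them writes `F
  -- 1` as a fixed linear combination of the `F (v i)`, which can be integrated termwise.
  let v : Fin (N + 1) → ℝ := fun i => ((i : ℝ) + 1)⁻¹ * (K + 1 : ℝ)⁻¹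
  have hv : InjOn v (Finset.univ : Finset (Fin (N + 1))) := by
    intro i _ j _ hij
    have hK1 : (K + 1 : ℝ)⁻¹ ≠ 0 := by positivity
    simp only [v, mul_eq_mul_right_iff, hK1, or_false, inv_inj,
      add_left_inj, Nat.cast_inj] at hij
    exact Fin.ext hij
  have hvI : ∀ i, I (v i) = ∫ x in closedBall (0 : 𝔼) R, (c - ‖x‖ ^ 2) ^ k := by
    intro i
    apply hsmall
    · positivity
    · have h1 : ((i : ℝ) + 1)⁻¹ ≤ 1 := inv_le_one_of_one_le₀ (by simp)
      have h2 : (K + 1 : ℝ)⁻¹ * K < 1 := by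
        rw [inv_mul_lt_iff₀ (by positivity)]; simp
      simp only [v, mul_assoc]
      refine lt_of_le_of_lt ?_ h2
      exact mul_le_of_le_one_left (by positivity) h1
  have hinterp : ∀ x, F 1 x = ∑ i, (Lagrange.basis Finset.univ v i).eval 1 * F (v i) x := by
    intro x
    obtain ⟨P, hP, hPe⟩ := hpoly x
    have := Lagrange.eq_interpolate_of_eval_eq (s := Finset.univ) (v := v) (f := P)
      (r := fun i => F (v i) x) hv (by
        refine (degree_le_natDegree).trans_lt ?_
        simp only [Finset.card_univ, Fintype.card_fin]
        exact_mod_cast Nat.lt_succ_of_le hP) (fun i _ => hPe _)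
    rw [← hPe 1, this, Lagrange.interpolate_apply, eval_finsetSum]
    refine Finset.sum_congr rfl fun i _ => ?_
    rw [eval_mul, eval_C, mul_comm]
  have h1 : I 1 = ∑ i, (Lagrange.basis Finset.univ v i).eval 1 * I (v i) := by
    simp only [hI, hinterp]
    rw [integral_finsetSum _ fun i _ => (hFi (v i)).const_mul _]
    simp_rw [integral_const_mul]
  have h2 : I 1 = ∫ x in closedBall (0 : 𝔼) R, (c - ‖x‖ ^ 2) ^ k := by
    rw [h1]
    simp_rw [hvI]
    rw [← Finset.sum_mul, ← eval_finsetSum,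
      Lagrange.sum_basis hv Finset.univ_nonempty, eval_one, one_mul]
  rw [← h2]
  simp [hI, hF]

/-- If `‖x + u x‖ ≥ η > 0` on the ball, the left side of `integral_perturbation_eq` is `O((c - η ^
2) ^ k)`, while the right side is at least a positive constant times `(c - r ^ 2) ^ k` for some `r <
η`. Large `k` is impossible. -/
theorem exists_add_eq_zero_of_contDiff {u : 𝔼 → 𝔼} (hu : ContDiff ℝ 1 u) {R : ℝ} (hR : 0 < R)
    (hu0 : ∀ x, R < ‖x‖ → u x = 0) : ∃ x, x + u x = 0 := by
  by_contra! hne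
  have hc := hu.continuous
  have hB : IsCompact (closedBall (0 : 𝔼) R) := isCompact_closedBall _ _
  have hBne : (closedBall (0 : 𝔼) R).Nonempty := ⟨0, by simp [hR.le]⟩
  have hg : Continuous fun x => ‖x + u x‖ := by fun_prop
  obtain ⟨x₀, hx₀B, hx₀⟩ := hB.exists_isMinOn hBne hg.continuousOn
  obtain ⟨x₁, -, hx₁⟩ := hB.exists_isMaxOn hBne hg.continuousOn
  have hdc : Continuous fun x => |(ContinuousLinearMap.id ℝ 𝔼 + fderiv ℝ u x).det| := by
    have := hu.continuous_fderiv one_ne_zero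
    exact (ContinuousLinearMap.continuous_det.comp (by fun_prop)).abs
  obtain ⟨x₂, -, hx₂⟩ := hB.exists_isMaxOn hBne hdc.continuousOn
  set D := |(ContinuousLinearMap.id ℝ 𝔼 + fderiv ℝ u x₂).det|
  set η := ‖x₀ + u x₀‖ with hη
  have hη0 : 0 < η := norm_pos_iff.2 (hne x₀)
  -- Large enough that `c - ‖x‖ ^ 2` and `c - ‖x + u x‖ ^ 2` are both nonnegative on the ball.
  set c := max R ‖x₁ + u x₁‖ ^ 2 with hcdef
  have hcη : η ^ 2 ≤ c := by
    have : η ≤ max R ‖x₁ + u x₁‖ := (hx₁ hx₀B).trans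
      (le_max_right _ _)
    exact pow_le_pow_left₀ hη0.le this 2
  set r := min η R / 2 with hr
  have hr0 : 0 < r := by positivity
  have hrη : r < η := by
    have := min_le_left η R
    have := lt_min hη0 hR
    linarith
  have hrR : r ≤ R := by
    have := min_le_right η R
    have := lt_min hη0 hR
    linarith
  have hq : c - η ^ 2 < c - r ^ 2 := by
    have : r ^ 2 < η ^ 2 := by gcongr
    linarith
  set vB := (volume : Measure 𝔼).real (closedBall 0 R)
  set vr := (volume : Measure 𝔼).real (closedBall 0 r)
  have hvr : 0 < vr := by
    refine ENNReal.toReal_pos (measure_closedBall_pos _ _ hr0).ne' measure_closedBall_lt_top.ne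
  have key : ∀ k : ℕ, vr * (c - r ^ 2) ^ k ≤ D * (c - η ^ 2) ^ k * vB := by
    intro k
    have hle : ∀ x ∈ closedBall (0 : 𝔼) R, 0 ≤ (c - ‖x‖ ^ 2) ^ k := by
      intro x hx
      rw [mem_closedBall_zero_iff] at hx
      have : ‖x‖ ^ 2 ≤ c := by
        rw [hcdef]; gcongr; exact hx.trans (le_max_left _ _)
      exact pow_nonneg (by linarith) _
    have hint : ∀ ρ, IntegrableOn (fun x : 𝔼 => (c - ‖x‖ ^ 2) ^ k) (closedBall 0 ρ) := fun ρ =>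
      (by fun_prop : Continuous fun x : 𝔼 => (c - ‖x‖ ^ 2) ^ k).continuousOn.integrableOn_compact
        (isCompact_closedBall _ _)
    calc vr * (c - r ^ 2) ^ k = ∫ _ in closedBall (0 : 𝔼) r, (c - r ^ 2) ^ k := by
          rw [setIntegral_const, smul_eq_mul]
      _ ≤ ∫ x in closedBall (0 : 𝔼) r, (c - ‖x‖ ^ 2) ^ k := by
          refine setIntegral_mono_on (integrableOn_const measure_closedBall_lt_top.ne) (hint r)
            measurableSet_closedBall fun x hx => ?_
          rw [mem_closedBall_zero_iff] at hx
          have h1 : (0 : ℝ) ≤ c - r ^ 2 := by nlinarith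
          gcongr
      _ ≤ ∫ x in closedBall (0 : 𝔼) R, (c - ‖x‖ ^ 2) ^ k :=
          setIntegral_mono_set (hint R)
            ((ae_restrict_iff' measurableSet_closedBall).2 (Eventually.of_forall hle))
            (closedBall_subset_closedBall hrR).eventuallyLE
      _ = ∫ x in closedBall (0 : 𝔼) R, (ContinuousLinearMap.id ℝ 𝔼 + fderiv ℝ u x).det *
            (c - ‖x + u x‖ ^ 2) ^ k := (integral_perturbation_eq hu hu0 c k).symm
      _ ≤ ‖∫ x in closedBall (0 : 𝔼) R, (ContinuousLinearMap.id ℝ 𝔼 + fderiv ℝ u x).det *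
            (c - ‖x + u x‖ ^ 2) ^ k‖ := Real.le_norm_self _
      _ ≤ D * (c - η ^ 2) ^ k * vB := by
          refine norm_setIntegral_le_of_norm_le_const measure_closedBall_lt_top fun x hx => ?_
          rw [norm_mul, norm_pow, Real.norm_eq_abs, Real.norm_eq_abs]
          have h1 : η ≤ ‖x + u x‖ := hx₀ hx
          have h2 : ‖x + u x‖ ^ 2 ≤ c := by
            have : ‖x + u x‖ ≤ max R ‖x₁ + u x₁‖ := (hx₁ hx).trans (le_max_right _ _)
            exact pow_le_pow_left₀ (norm_nonneg _) this 2
          rw [abs_of_nonneg (by linarith : 0 ≤ c - ‖x + u x‖ ^ 2)]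
          have h3 : η ^ 2 ≤ ‖x + u x‖ ^ 2 := by gcongr
          have h4 : |(ContinuousLinearMap.id ℝ 𝔼 + fderiv ℝ u x).det| ≤ D := hx₂ hx
          have h5 : (0 : ℝ) ≤ D := abs_nonneg _
          gcongr
  have hlim : Tendsto (fun k : ℕ => D * ((c - η ^ 2) / (c - r ^ 2)) ^ k * vB) atTop
      (𝓝 (D * 0 * vB)) := by
    refine ((tendsto_pow_atTop_nhds_zero_of_lt_one ?_ ?_).const_mul D).mul_const vB
    · exact div_nonneg (by linarith) (by linarith)
    · rw [div_lt_one (by linarith)]; exact hq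
  have : vr ≤ D * 0 * vB := by
    refine ge_of_tendsto' hlim fun k => ?_
    have hpos : 0 < (c - r ^ 2) ^ k := pow_pos (by linarith) _
    rw [div_pow, mul_div_assoc', div_mul_eq_mul_div, le_div_iff₀ hpos]
    exact key k
  simp at this
  exact absurd hvr this.not_gt

/-- A continuous perturbation of the identity with compact support is onto. -/
theorem exists_add_eq_zero_of_continuous {v : 𝔼 → 𝔼} (hv : Continuous v) {R : ℝ} (hR : 0 < R)
    (hv0 : ∀ x, R < ‖x‖ → v x = 0) : ∃ x, x + v x = 0 := by
  by_contra! hne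
  have hB : IsCompact (closedBall (0 : 𝔼) R) := isCompact_closedBall _ _
  have hBne : (closedBall (0 : 𝔼) R).Nonempty := ⟨0, by simp [hR.le]⟩
  have hg : Continuous fun x => ‖x + v x‖ := by fun_prop
  obtain ⟨x₀, -, hx₀⟩ := hB.exists_isMinOn hBne hg.continuousOn
  -- The bound by `R` handles zeros of `x + u x` outside the ball, where `v x = 0` and the
  -- approximation would force `‖x‖ < η ≤ R`.
  set η := min ‖x₀ + v x₀‖ R
  have hη0 : 0 < η := lt_min (norm_pos_iff.2 (hne x₀)) hR
  obtain ⟨u, hu, hclose, hsupp⟩ := hv.exists_contDiff_approx 1 (continuous_const (y := η))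
    fun _ => hη0
  have hu0 : ∀ x, R < ‖x‖ → u x = 0 := fun x hx => by
    by_contra h
    exact hsupp h (hv0 x hx)
  obtain ⟨x, hx⟩ := exists_add_eq_zero_of_contDiff hu hR hu0
  have h1 := hclose x
  rw [dist_eq_norm, show u x - v x = -(x + v x) by rw [eq_neg_of_add_eq_zero_right hx]; abel,
    norm_neg] at h1
  rcases le_or_gt ‖x‖ R with h | h
  · exact absurd ((hx₀ (mem_closedBall_zero_iff.2 h)).trans' (min_le_left _ _)) h1.not_ge
  · rw [hv0 x h, add_zero] at h1
    exact absurd (h1.trans_le (min_le_right _ _)) h.not_gt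

/-- A form of Brouwer's fixed point theorem: a continuous map on a closed ball that displaces no
point by more than the radius has a zero. -/
theorem exists_zero_of_norm_sub_le {G : 𝔼 → 𝔼} {R : ℝ} (hR : 0 < R)
    (hG : ContinuousOn G (closedBall 0 R)) (hGR : ∀ x ∈ closedBall (0 : 𝔼) R, ‖G x - x‖ ≤ R) :
    ∃ x ∈ closedBall (0 : 𝔼) R, G x = 0 := by
  set p : 𝔼 → 𝔼 := fun x => (R / max R ‖x‖) • x with hp
  have hmax : ∀ x : 𝔼, 0 < max R ‖x‖ := fun x => lt_max_of_lt_left hR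
  have hpc : Continuous p := by
    refine Continuous.smul (Continuous.div continuous_const (by fun_prop) fun x => (hmax x).ne')
      continuous_id
  have hpB : ∀ x, p x ∈ closedBall (0 : 𝔼) R := fun x => by
    rw [mem_closedBall_zero_iff, hp]
    simp only [norm_smul, Real.norm_eq_abs, abs_of_pos (div_pos hR (hmax x))]
    rw [div_mul_eq_mul_div, div_le_iff₀ (hmax x)]
    exact mul_le_mul_of_nonneg_left (le_max_right _ _) hR.le
  have hpid : ∀ x ∈ closedBall (0 : 𝔼) R, p x = x := fun x hx => by
    rw [mem_closedBall_zero_iff] at hx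
    simp [hp, max_eq_left hx, hR.ne']
  -- A cutoff equal to 1 on the ball of radius `R` and 0 beyond `2 * R`. With the radial retraction
  -- `p` it extends `G - id` to a compactly supported field; the bound on `‖G x - x‖` forces the
  -- resulting zero back into the ball.
  set μ : 𝔼 → ℝ := fun x => max 0 (min 1 (2 - ‖x‖ / R))
  have hμ0 : ∀ x, 0 ≤ μ x := fun x => le_max_left _ _
  have hμ1 : ∀ x, μ x ≤ 1 := fun x => max_le zero_le_one (min_le_left _ _)
  have hμc : Continuous μ := by fun_prop
  have hGp : Continuous fun x => G (p x) := hG.comp_continuous hpc hpB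
  obtain ⟨x, hx⟩ := exists_add_eq_zero_of_continuous
    (v := fun x => μ x • (G (p x) - p x)) (hμc.smul (hGp.sub hpc)) (R := 2 * R) (by positivity) (by
      intro x hx
      have : μ x = 0 := by
        refine max_eq_left ((min_le_right _ _).trans ?_)
        rw [sub_nonpos, le_div_iff₀ hR]
        exact hx.le
      simp [this])
  have hxR : x ∈ closedBall (0 : 𝔼) R := by
    rw [mem_closedBall_zero_iff, eq_neg_of_add_eq_zero_left hx, norm_neg, norm_smul,
      Real.norm_of_nonneg (hμ0 x)]
    calc μ x * _ ≤ 1 * R := mul_le_mul (hμ1 x) (hGR _ (hpB x)) (norm_nonneg _) zero_le_one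
      _ = R := one_mul R
  refine ⟨x, hxR, ?_⟩
  have : μ x = 1 := by
    rw [mem_closedBall_zero_iff] at hxR
    have : ‖x‖ / R ≤ 1 := (div_le_one hR).2 hxR
    simp only [μ]
    rw [min_eq_left (by linarith), max_eq_right zero_le_one]
  simp only [this, one_smul, hpid x hxR] at hx
  rwa [add_sub_cancel] at hx

end Brouwer

/-! ### Invariance of domain, and non-separation by sets of codimension two. -/

section InvarianceOfDomain

open Set Metric MeasureTheory Filter Topology

variable {n : ℕ}

local notation "𝔼" => EuclideanSpace ℝ (Fin n)

/-- An injective continuous map on a compact set is a closed embedding, so Tietze extends its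
inverse. -/
theorem exists_continuous_leftInverse_of_injOn_isCompact {Y : Type*} [TopologicalSpace Y]
    [T2Space Y] [NormalSpace Y] {s : Set 𝔼} (hs : IsCompact s) {f : 𝔼 → Y}
    (hf : ContinuousOn f s) (hinj : InjOn f s) :
    ∃ g : Y → 𝔼, Continuous g ∧ ∀ x ∈ s, g (f x) = x := by
  have := isCompact_iff_compactSpace.1 hs
  have he : IsClosedEmbedding (s.domRestrict f) :=
    (continuousOn_iff_continuous_domRestrict.1 hf).isClosedEmbedding (injOn_iff_injective.1 hinj)
  obtain ⟨g, hg⟩ := ContinuousMap.exists_extension he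
    (⟨Subtype.val, continuous_subtype_val⟩ : C(s, 𝔼))
  exact ⟨g, g.continuous, fun x hx => DFunLike.congr_fun hg ⟨x, hx⟩⟩

/-- Local form of Brouwer's invariance of domain. -/
theorem image_closedBall_mem_nhds_of_injOn {f : 𝔼 → 𝔼} {R : ℝ} (hR : 0 < R)
    (hf : ContinuousOn f (closedBall 0 R)) (hinj : InjOn f (closedBall 0 R)) :
    f '' closedBall 0 R ∈ 𝓝 (f 0) := by
  by_contra hK
  have hB : IsCompact (closedBall (0 : 𝔼) R) := isCompact_closedBall _ _
  have h0B : (0 : 𝔼) ∈ closedBall (0 : 𝔼) R := by simp [hR.le]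
  -- `G` extends the inverse of `f` from `K`, so `G ∘ f` is the identity on the ball. If `K` misses
  -- some `c` near `f 0`, a modification of `G` near `c` has no zero on the relevant set, although
  -- its composite with `f` stays close enough to the identity for Brouwer to give a zero.
  obtain ⟨G, hG, hGf⟩ := exists_continuous_leftInverse_of_injOn_isCompact hB hf hinj
  have hGf0 : G (f 0) = 0 := hGf 0 h0B
  set K := f '' closedBall 0 R
  have hKc : IsCompact K := hB.image_of_continuousOn hf
  obtain ⟨ε, hε, hGε⟩ : ∃ ε > 0, ∀ y, dist y (f 0) < 2 * ε → ‖G y‖ < R / 4 := by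
    obtain ⟨ε, hε, h⟩ := Metric.continuousAt_iff.1 hG.continuousAt (R / 4) (by positivity)
    refine ⟨ε / 2, by positivity, fun y hy => ?_⟩
    have := h (by linarith : dist y (f 0) < ε)
    rwa [hGf0, dist_zero_right] at this
  obtain ⟨c, hc, hcK⟩ : ∃ c, dist c (f 0) < ε ∧ c ∉ K := by
    by_contra! h
    exact hK (Filter.mem_of_superset (ball_mem_nhds _ hε) fun y hy => h y hy)
  have hfar : IsCompact (K ∩ {y | ε ≤ dist y c}) :=
    hKc.inter_right (isClosed_le continuous_const (by fun_prop))
  obtain ⟨m, hm, hGm⟩ : ∃ m > 0, ∀ y ∈ K, ε ≤ dist y c → m ≤ ‖G y‖ := by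
    rcases (K ∩ {y | ε ≤ dist y c}).eq_empty_or_nonempty with h | h
    · exact ⟨1, one_pos, fun y hy hyc => absurd (show y ∈ K ∩ {y | ε ≤ dist y c} from ⟨hy, hyc⟩)
        (by simp [h])⟩
    · obtain ⟨y, ⟨⟨x, hx, rfl⟩, hyc⟩, hmin⟩ := hfar.exists_isMinOn h hG.norm.continuousOn
      refine ⟨‖G (f x)‖, norm_pos_iff.2 fun h0 => ?_, fun y hy hyc => hmin ⟨hy, hyc⟩⟩
      rw [hGf x hx] at h0
      rw [h0, mem_ofPred_eq, dist_comm] at hyc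
      exact absurd hc hyc.not_gt
  set κ := min (m / 3) (R / 4)
  have hκ : 0 < κ := by positivity
  have hκm : κ ≤ m / 3 := min_le_left _ _
  have hκR : κ ≤ R / 4 := min_le_right _ _
  obtain ⟨P, hP, hPG, -⟩ := hG.exists_contDiff_approx 1 (continuous_const (y := κ)) fun _ => hκ
  -- `P` is `C¹`, so it maps the null set `sphere c ε` to a null set, and a small translation moves
  -- 0 off the image.
  obtain ⟨w, hw, hwP⟩ : ∃ w : 𝔼, ‖w‖ < κ ∧ w ∉ P '' sphere c ε := by
    by_contra! h
    have h1 : volume (P '' sphere c ε) = 0 :=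
      addHaar_image_eq_zero_of_differentiableOn_of_addHaar_eq_zero _
        (hP.differentiable one_ne_zero).differentiableOn
        (Measure.addHaar_sphere_of_ne_zero _ _ hε.ne')
    have h2 : volume (ball (0 : 𝔼) κ) = 0 :=
      measure_mono_null (fun w hw => h w (by simpa using hw)) h1
    exact (measure_ball_pos volume (0 : 𝔼) hκ).ne' h2
  -- Pushes the points of `K` within `ε` of `c` radially onto the sphere and fixes the others; this
  -- is continuous on `K` because `c ∉ K`.
  set Φ : 𝔼 → 𝔼 := fun y => c + max (ε / dist y c) 1 • (y - c) with hΦ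
  have hdist : ∀ y ∈ K, dist y c ≠ 0 := fun y hy h => hcK (dist_eq_zero.1 h ▸ hy)
  have hΦc : ContinuousOn Φ K := by
    have : ContinuousOn (fun y => ε / dist y c) K :=
      ContinuousOn.div continuousOn_const (by fun_prop) hdist
    exact continuousOn_const.add ((this.sup continuousOn_const).smul (by fun_prop))
  have hΦfar : ∀ y ∈ K, ε ≤ dist y c → Φ y = y := fun y hy hyc => by
    have : ε / dist y c ≤ 1 := (div_le_one (hε.trans_le hyc)).2 hyc
    simp [hΦ, max_eq_right this]
  have hΦnear : ∀ y ∈ K, dist y c ≤ ε → Φ y ∈ sphere c ε := fun y hy hyc => by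
    have hpos := lt_of_le_of_ne dist_nonneg (hdist y hy).symm
    have : 1 ≤ ε / dist y c := (one_le_div hpos).2 hyc
    simp only [hΦ, max_eq_left this, mem_sphere_iff_norm, add_sub_cancel_left, norm_smul,
      norm_div, Real.norm_of_nonneg hε.le, Real.norm_of_nonneg hpos.le, ← dist_eq_norm]
    rw [div_mul_cancel₀ _ hpos.ne']
  have hPGn : ∀ y, ‖P y - G y‖ < κ := fun y => by rw [← dist_eq_norm]; exact hPG y
  obtain ⟨x, hx, hx0⟩ := exists_zero_of_norm_sub_le (G := fun x => P (Φ (f x)) - w) hR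
    ((hP.continuous.comp_continuousOn (hΦc.comp hf (mapsTo_image _ _))).sub continuousOn_const) (by
      intro x hx
      have hy : f x ∈ K := mem_image_of_mem f hx
      rcases le_total ε (dist (f x) c) with h | h
      · have h1 := hPGn (f x)
        rw [hGf x hx] at h1
        simp only [hΦfar _ hy h]
        calc ‖P (f x) - w - x‖ = ‖(P (f x) - x) - w‖ := by congr 1; abel
          _ ≤ ‖P (f x) - x‖ + ‖w‖ := norm_sub_le _ _
          _ ≤ R := by linarith
      · have h1 := hΦnear _ hy h
        have h2 : ‖G (Φ (f x))‖ < R / 4 := by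
          apply hGε
          rw [mem_sphere] at h1
          linarith [dist_triangle (Φ (f x)) c (f 0)]
        have h3 : ‖G (f x)‖ < R / 4 := by
          apply hGε
          linarith [dist_triangle (f x) c (f 0)]
        rw [hGf x hx] at h3
        have h4 := hPGn (Φ (f x))
        calc ‖P (Φ (f x)) - w - x‖
            = ‖(P (Φ (f x)) - G (Φ (f x))) + G (Φ (f x)) - w - x‖ := by congr 1; abel
          _ ≤ ‖P (Φ (f x)) - G (Φ (f x))‖ + ‖G (Φ (f x))‖ + ‖w‖ + ‖x‖ :=
            (norm_sub_le _ _).trans (add_le_add_left ((norm_sub_le _ _).trans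
              (add_le_add_left (norm_add_le _ _) _)) _)
          _ ≤ R := by linarith)
  have hy : f x ∈ K := mem_image_of_mem f hx
  have hx0' := sub_eq_zero.1 hx0
  rcases le_total ε (dist (f x) c) with h | h
  · rw [hΦfar _ hy h] at hx0'
    have h1 := hPGn (f x)
    have h2 := hGm _ hy h
    rw [hx0'] at h1
    have : ‖G (f x)‖ ≤ ‖w - G (f x)‖ + ‖w‖ := by
      calc ‖G (f x)‖ = ‖w - (w - G (f x))‖ := by congr 1; abel
        _ ≤ _ := (norm_sub_le _ _).trans_eq (add_comm _ _)
    linarith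
  · exact hwP ⟨_, hΦnear _ hy h, hx0'⟩

theorem exists_openPartialHomeomorph_map_eq_zero {Y : Type*} [TopologicalSpace Y]
    [ChartedSpace 𝔼 Y] (y : Y) :
    ∃ φ : OpenPartialHomeomorph Y 𝔼, y ∈ φ.source ∧ φ y = 0 :=
  ⟨(chartAt 𝔼 y).transHomeomorph (Homeomorph.addRight (-chartAt 𝔼 y y)), by simp, by simp⟩

/-- A point of a manifold has arbitrarily small neighbourhoods that are images of balls. -/
theorem exists_closedBall_subset_chart {Y : Type*} [TopologicalSpace Y] {y : Y}
    {φ : OpenPartialHomeomorph Y 𝔼} (hy : y ∈ φ.source) (hφ : φ y = 0) {N : Set Y}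
    (hN : N ∈ 𝓝 y) :
    ∃ R > 0, closedBall 0 R ⊆ φ.target ∧ ∀ x ∈ closedBall (0 : 𝔼) R, φ.symm x ∈ N := by
  have h0 : (0 : 𝔼) ∈ φ.target := hφ ▸ φ.map_source hy
  have h1 : φ.symm ⁻¹' N ∈ 𝓝 (0 : 𝔼) := by
    apply (φ.continuousAt_symm h0).preimage_mem_nhds
    rwa [← hφ, φ.left_inv hy]
  obtain ⟨R, hR, hsub⟩ := Metric.nhds_basis_closedBall.mem_iff.1
    (Filter.inter_mem (φ.open_target.mem_nhds h0) h1)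
  exact ⟨R, hR, fun x hx => (hsub hx).1, fun x hx => (hsub hx).2⟩

/-- Invariance of domain for maps into a manifold. -/
theorem image_closedBall_mem_nhds_of_injOn_manifold {Y : Type*} [TopologicalSpace Y]
    [ChartedSpace 𝔼 Y] {j : 𝔼 → Y} {R : ℝ} (hR : 0 < R)
    (hj : ContinuousOn j (closedBall 0 R)) (hinj : InjOn j (closedBall 0 R)) :
    j '' closedBall 0 R ∈ 𝓝 (j 0) := by
  obtain ⟨φ, h0, hφ0⟩ := exists_openPartialHomeomorph_map_eq_zero (n := n) (j 0)
  have hcont : ContinuousAt j 0 := hj.continuousAt (closedBall_mem_nhds _ hR)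
  obtain ⟨r, hr, hsub⟩ := Metric.nhds_basis_closedBall.mem_iff.1
    (Filter.inter_mem (hcont.preimage_mem_nhds (φ.open_source.mem_nhds h0))
      (closedBall_mem_nhds (0 : 𝔼) hR))
  have hf : ContinuousOn (φ ∘ j) (closedBall 0 r) :=
    φ.continuousOn.comp (hj.mono fun x hx => (hsub hx).2) fun x hx => (hsub hx).1
  have hfinj : InjOn (φ ∘ j) (closedBall 0 r) :=
    φ.injOn.comp (hinj.mono fun x hx => (hsub hx).2) fun x hx => (hsub hx).1
  have himg := image_closedBall_mem_nhds_of_injOn hr hf hfinj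
  filter_upwards [φ.open_source.mem_nhds h0, (φ.continuousAt h0).preimage_mem_nhds himg]
    with y hy ⟨x, hx, hxy⟩
  exact ⟨x, (hsub hx).2, φ.injOn (hsub hx).1 hy hxy⟩

/-- A closed set of codimension at least two does not separate a ball. -/
theorem mem_or_mem_of_forall_inter_subset {W : Type*} [NormedAddCommGroup W] [NormedSpace ℝ W]
    [FiniteDimensional ℝ W] {e : 𝔼 → W} {R : ℝ} (he : ContinuousOn e (closedBall 0 R))
    (hinj : InjOn e (closedBall 0 R)) {P Q : Set W} (hP : IsClosed P) (hQ : IsClosed Q)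
    (hPQ : ∀ x ∈ closedBall 0 R, e x ∈ P ∪ Q) {ι : Type*} [Finite ι] (c : ι → W)
    (S : ι → Submodule ℝ W) (hS : ∀ i, Module.finrank ℝ (S i) + 1 < n)
    (hcS : ∀ x ∈ closedBall 0 R, e x ∈ P → e x ∈ Q → ∃ i, e x - c i ∈ S i)
    {y₀ y₁ : 𝔼} (hy₀ : y₀ ∈ ball 0 R) (hy₁ : y₁ ∈ ball 0 R) : e y₀ ∈ Q ∨ e y₁ ∈ P := by
  by_contra! hcon
  obtain ⟨h₀, h₁⟩ := hcon
  have hB : IsCompact (closedBall (0 : 𝔼) R) := isCompact_closedBall _ _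
  obtain ⟨h, hh, hhe⟩ := exists_continuous_leftInverse_of_injOn_isCompact hB he hinj
  have hnear : ∀ (y : 𝔼) (A : Set W), y ∈ ball (0 : 𝔼) R → IsClosed A → e y ∉ A →
      ∃ δ > 0, ∀ x, dist x y < δ → e x ∉ A := by
    intro y A hy hA hyA
    exact Metric.eventually_nhds_iff.1 ((he.continuousAt
      (mem_of_superset (isOpen_ball.mem_nhds hy) ball_subset_closedBall)).preimage_mem_nhds
        (hA.isOpen_compl.mem_nhds hyA))
  obtain ⟨δ₀, hδ₀, hQ₀⟩ := hnear y₀ Q hy₀ hQ h₀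
  obtain ⟨δ₁, hδ₁, hP₁⟩ := hnear y₁ P hy₁ hP h₁
  rw [mem_ball_zero_iff] at hy₀ hy₁
  set ρ := max ‖y₀‖ ‖y₁‖
  have hρ : ρ < R := max_lt hy₀ hy₁
  have hR : 0 < R := (norm_nonneg _).trans_lt hy₀
  set δ := min (min δ₀ δ₁) (R - ρ) / 2 with hδdef
  have hδm : 0 < min (min δ₀ δ₁) (R - ρ) := by
    have := sub_pos.2 hρ
    positivity
  have hδ : 0 < δ := half_pos hδm
  have hδ₀' : 2 * δ ≤ δ₀ := by
    rw [hδdef]; linarith [min_le_left (min δ₀ δ₁) (R - ρ), min_le_left δ₀ δ₁]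
  have hδ₁' : 2 * δ ≤ δ₁ := by
    rw [hδdef]; linarith [min_le_left (min δ₀ δ₁) (R - ρ), min_le_right δ₀ δ₁]
  have hδR : 2 * δ + ρ ≤ R := by
    rw [hδdef]; linarith [min_le_right (min δ₀ δ₁) (R - ρ)]
  obtain ⟨g, hg, hgh, -⟩ := hh.exists_contDiff_approx 1 (continuous_const (y := δ)) fun _ => hδ
  set v := y₁ - y₀
  -- The smoothed inverse sends each affine piece, swept in direction `v`, to a set of dimension at
  -- most `n - 1`. A generic `z` near `y₀` therefore starts a line that avoids the images of all the
  -- pieces.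
  obtain ⟨z, hz, hzg⟩ : ∃ z, dist z y₀ < δ ∧
      ∀ i, ∀ s ∈ S i, ∀ t : ℝ, g (c i + s) ≠ z + t • v := by
    let F : (i : ι) → S i × ℝ → 𝔼 := fun i p => g (c i + p.1) - p.2 • v
    have hF : ∀ i, ContDiff ℝ 1 (F i) := fun i => by
      have h1 : ContDiff ℝ 1 fun p : S i × ℝ => ((p.1 : S i) : W) :=
        (S i).subtypeL.contDiff.comp contDiff_fst
      exact (hg.comp (contDiff_const.add h1)).sub (contDiff_snd.smul contDiff_const)
    have hdim : dimH (⋃ i, range (F i)) < Module.finrank ℝ 𝔼 := by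
      have hn : 0 < n := by
        rcases Nat.eq_zero_or_pos n with rfl | hn
        · rw [Subsingleton.elim y₁ y₀] at h₁
          exact ((hPQ y₀ (mem_closedBall_zero_iff.2 hy₀.le)).elim h₁ h₀).elim
        · exact hn
      refine lt_of_le_of_lt (b := ((n - 1 : ℕ) : ℝ≥0∞)) ?_ ?_
      · rw [dimH_iUnion]
        refine iSup_le fun i => (hF i).dimH_range_le.trans ?_
        have := hS i
        rw [Module.finrank_prod, Module.finrank_self]
        exact_mod_cast by omega
      · rw [finrank_euclideanSpace_fin]
        exact_mod_cast by omega
    obtain ⟨z, hz, hzd⟩ := (dense_compl_of_dimH_lt_finrank hdim).exists_dist_lt y₀ hδ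
    refine ⟨z, by rwa [dist_comm], fun i s hs t hst => hz ?_⟩
    exact mem_iUnion.2 ⟨i, (⟨s, hs⟩, t), by simp [F, hst]⟩
  set H : 𝔼 → 𝔼 := fun x => g (e x)
  have hH : ContinuousOn H (closedBall 0 R) := hg.continuous.comp_continuousOn he
  have hHx : ∀ x ∈ closedBall 0 R, dist (H x) x < δ := fun x hx => by
    simpa [H, hhe x hx] using hgh (e x)
  set T : Set 𝔼 := (fun t : ℝ => z + t • v) '' Icc 0 1
  have hT : IsClosed T := (isCompact_Icc.image (by fun_prop)).isClosed
  have hclosed : ∀ A : Set W, IsClosed A → IsClosed (closedBall 0 R ∩ e ⁻¹' A ∩ H ⁻¹' T) :=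
    fun A hA => (hH.mono inter_subset_left).preimage_isClosed_of_isClosed
      (he.preimage_isClosed_of_isClosed isClosed_closedBall hA) hT
  -- The values are crossed on purpose. A solution of `H x = z + l x • v` in `P` has `l x = 1` and
  -- lies near `y₁`, where `P` is absent; one in `Q` has `l x = 0` and lies near `y₀`, where `Q` is
  -- absent.
  obtain ⟨l, hlQ, hlP, hl⟩ := exists_continuous_zero_one_of_isClosed
    (hclosed Q hQ) (hclosed P hP) (by
    rw [Set.disjoint_left]
    rintro x ⟨⟨hxB, hxQ⟩, t, -, hxT⟩ ⟨⟨-, hxP⟩, -⟩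
    obtain ⟨i, hi⟩ := hcS x hxB hxP hxQ
    exact hzg i _ hi t (by simpa [H] using hxT.symm))
  obtain ⟨x, hx, hx0⟩ := exists_zero_of_norm_sub_le (G := fun x => H x - (z + l x • v)) hR
    (hH.sub (by fun_prop)) (by
      intro x hx
      have h1 : ‖y₀ + l x • v‖ ≤ ρ := by
        have : y₀ + l x • v = (1 - l x) • y₀ + l x • y₁ := by
          simp only [v, smul_sub, sub_smul, one_smul]; abel
        rw [this]
        refine mem_closedBall_zero_iff.1 ((convex_closedBall (0 : 𝔼) ρ) ?_ ?_
          (sub_nonneg.2 (hl x).2) (hl x).1 (by ring)) <;> simp [ρ]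
      have h2 := hHx x hx
      rw [dist_eq_norm] at h2 hz
      calc ‖H x - (z + l x • v) - x‖ = ‖(H x - x) - (z - y₀) - (y₀ + l x • v)‖ := by
            congr 1; abel
        _ ≤ ‖H x - x‖ + ‖z - y₀‖ + ‖y₀ + l x • v‖ :=
            (norm_sub_le _ _).trans (add_le_add_left (norm_sub_le _ _) _)
        _ ≤ R := by linarith)
  have hx0' := sub_eq_zero.1 hx0
  have hxT : x ∈ H ⁻¹' T := ⟨l x, hl x, hx0'.symm⟩
  have h2 := hHx x hx
  rcases hPQ x hx with hxP | hxQ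
  · have : l x = 1 := hlP ⟨⟨hx, hxP⟩, hxT⟩
    rw [this, one_smul] at hx0'
    refine hP₁ x ?_ hxP
    have h3 : dist (z + v) y₁ = dist z y₀ := by
      rw [dist_eq_norm, dist_eq_norm]; congr 1; simp only [v]; abel
    rw [hx0'] at h2
    linarith [dist_triangle_left x y₁ (z + v)]
  · have : l x = 0 := hlQ ⟨⟨hx, hxQ⟩, hxT⟩
    rw [this, zero_smul, add_zero] at hx0'
    refine hQ₀ x ?_ hxQ
    rw [hx0'] at h2
    linarith [dist_triangle_left x y₀ z]

end InvarianceOfDomain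

/-! ### Combinatorial consequences of being a manifold. -/

section Realization

open Set Metric Filter Topology

variable {n : ℕ}

local notation "𝔼" => EuclideanSpace ℝ (Fin n)

theorem image_closedBall_mem_nhdsWithin_of_injOn {W : Type*} [TopologicalSpace W] {Y : Set W}
    [ChartedSpace 𝔼 Y] {j : 𝔼 → W} {R : ℝ} (hR : 0 < R) (hj : ContinuousOn j (closedBall 0 R))
    (hinj : InjOn j (closedBall 0 R)) (hjY : MapsTo j (closedBall 0 R) Y) :
    j '' closedBall 0 R ∈ 𝓝[Y] (j 0) := by
  classical
  have h0 : (0 : 𝔼) ∈ closedBall (0 : 𝔼) R := by simp [hR.le]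
  let i : 𝔼 → Y := fun u => if h : j u ∈ Y then ⟨j u, h⟩ else ⟨j 0, hjY h0⟩
  have hi : ∀ u ∈ closedBall (0 : 𝔼) R, (i u : W) = j u := fun u hu => by simp [i, hjY hu]
  have hic : ContinuousOn i (closedBall 0 R) :=
    Topology.IsInducing.subtypeVal.continuousOn_iff.2 (hj.congr hi)
  have hii : InjOn i (closedBall 0 R) := fun x hx y hy hxy =>
    hinj hx hy (by rw [← hi x hx, ← hi y hy, hxy])
  have := image_closedBall_mem_nhds_of_injOn_manifold hR hic hii
  rw [mem_nhds_subtype_iff_nhdsWithin, hi 0 h0] at this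
  refine mem_of_superset this ?_
  rintro _ ⟨_, ⟨u, hu, rfl⟩, rfl⟩
  exact ⟨u, hu, (hi u hu).symm⟩

namespace AbstractSimplicialComplex

theorem mem_of_subset_of_nonempty {V : Type*} {K : AbstractSimplicialComplex V} {s t : Finset V}
    (hs : s ∈ K) (hts : t ⊆ s) (ht : t.Nonempty) :
    t ∈ K :=
  (K.isRelLowerSet_faces hs).2 hts ht

theorem nonempty_of_mem {V : Type*} {K : AbstractSimplicialComplex V} {s : Finset V}
    (hs : s ∈ K) : s.Nonempty :=
  (K.isRelLowerSet_faces hs).1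

variable {V : Type*} [Fintype V] {K : AbstractSimplicialComplex V}

theorem sum_eq_one_of_subset {x : V → ℝ} {s : Finset V} (hx : x ∈ stdSimplex ℝ V)
    (hs : ∀ v, x v ≠ 0 → v ∈ s) : ∑ v ∈ s, x v = 1 := by
  rw [← hx.2]
  exact Finset.sum_subset (Finset.subset_univ _) fun v _ hv => by
    by_contra h
    exact hv (hs v h)

/-- A face has points of the relative interior arbitrarily close to each of its points. -/
theorem exists_mem_forall_pos {s : Finset V} (hs : s ∈ K) {x : V → ℝ} (hx : x ∈ stdSimplex ℝ V)
    (hxs : ∀ v, x v ≠ 0 → v ∈ s) {N : Set (V → ℝ)} (hN : N ∈ 𝓝[K.realization] x) :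
    ∃ y ∈ N, y ∈ stdSimplex ℝ V ∧ (∀ v ∈ s, 0 < y v) ∧ ∀ v, y v ≠ 0 → v ∈ s := by
  classical
  have hcard : (0 : ℝ) < s.card := by exact_mod_cast (nonempty_of_mem hs).card_pos
  let b : V → ℝ := fun v => if v ∈ s then (s.card : ℝ)⁻¹ else 0
  have hb : b ∈ stdSimplex ℝ V := by
    refine ⟨fun v => ?_, ?_⟩
    · simp only [b]; split_ifs <;> positivity
    · simp [b, hcard.ne']
  let γ : ℝ → V → ℝ := fun t => (1 - t) • x + t • b
  have hγs : ∀ t v, γ t v ≠ 0 → v ∈ s := fun t v hv => by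
    by_contra h
    have : x v = 0 := by by_contra h'; exact h (hxs v h')
    exact hv (by simp [γ, b, h, this])
  have hγm : ∀ t ∈ Icc (0 : ℝ) 1, γ t ∈ stdSimplex ℝ V := fun t ht =>
    convex_stdSimplex ℝ V hx hb (sub_nonneg.2 ht.2) ht.1 (by ring)
  have hγ0 : γ 0 = x := by simp [γ]
  have hγc : ContinuousWithinAt γ (Icc 0 1) 0 := by
    have : Continuous γ := by fun_prop
    exact this.continuousWithinAt
  have hev : ∀ᶠ t in 𝓝[Icc 0 1] (0 : ℝ), γ t ∈ N := by
    refine hγc.tendsto_nhdsWithin (t := K.realization) (fun t ht => ⟨hγm t ht, s, hs, hγs t⟩) ?_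
    rwa [hγ0]
  have hev' : ∀ᶠ t in 𝓝[>] (0 : ℝ), γ t ∈ N ∧ t ∈ Ioc (0 : ℝ) 1 := by
    have h1 : ∀ᶠ t in 𝓝[>] (0 : ℝ), t ∈ Ioc (0 : ℝ) 1 := Ioc_mem_nhdsGT one_pos
    have h2 : 𝓝[Ioc (0 : ℝ) 1] 0 ≤ 𝓝[Icc 0 1] (0 : ℝ) := nhdsWithin_mono _ Ioc_subset_Icc_self
    rw [nhdsWithin_Ioc_eq_nhdsGT one_pos] at h2
    exact (hev.filter_mono h2).and h1
  obtain ⟨t, htN, ht⟩ := hev'.exists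
  refine ⟨γ t, htN, hγm t (Ioc_subset_Icc_self ht), fun v hv => ?_, hγs t⟩
  have h1 : 0 ≤ (1 - t) * x v := mul_nonneg (sub_nonneg.2 ht.2) (hx.1 v)
  have h2 : 0 < t * (s.card : ℝ)⁻¹ := mul_pos ht.1 (by positivity)
  have : γ t v = (1 - t) * x v + t * (s.card : ℝ)⁻¹ := by simp [γ, b, hv]
  linarith

theorem exists_mem_realization_pos {s : Finset V} (hs : s ∈ K) :
    ∃ y ∈ K.realization, (∀ v ∈ s, 0 < y v) ∧ ∀ v, y v ≠ 0 → v ∈ s := by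
  classical
  obtain ⟨w, hw⟩ := nonempty_of_mem hs
  obtain ⟨y, -, hy, hpos, hsup⟩ := exists_mem_forall_pos hs (single_mem_stdSimplex ℝ w)
    (fun v hv => by
      by_contra h
      exact hv (Pi.single_eq_of_ne (by rintro rfl; exact h hw) _)) univ_mem
  exact ⟨y, ⟨hy, s, hs, hsup⟩, hpos, hsup⟩

/-- In a triangulated `n`-manifold, the faces containing a face with at most `n` vertices span more
than one additional vertex. -/
theorem exists_superset_not_subset_insert [DecidableEq V] [ChartedSpace 𝔼 K.realization]
    {s : Finset V} (hs : s ∈ K) (hsn : s.card ≤ n) (a : V) :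
    ∃ ρ ∈ K, s ⊆ ρ ∧ ¬ρ ⊆ insert a s := by
  by_contra! hstar
  obtain ⟨x₀, hx₀, hpos, hsup⟩ := exists_mem_realization_pos hs
  obtain ⟨φ, hφs, hφ0⟩ := exists_openPartialHomeomorph_map_eq_zero (n := n)
    (⟨x₀, hx₀⟩ : K.realization)
  have hN : {x : K.realization | ∀ v ∈ s, 0 < x.1 v} ∈ 𝓝 (⟨x₀, hx₀⟩ : K.realization) := by
    refine IsOpen.mem_nhds ?_ hpos
    simp only [ofPred_forall]
    refine isOpen_biInter_finset fun v _ => ?_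
    exact isOpen_lt continuous_const ((continuous_apply v).comp continuous_subtype_val)
  obtain ⟨R, hR, hRt, hRN⟩ := exists_closedBall_subset_chart hφs hφ0 hN
  obtain ⟨ι⟩ : Nonempty (s ↪ Fin n) := by
    apply Function.Embedding.nonempty_of_card_le
    simpa using hsn
  -- Near an interior point of `s` the realization would lie in the single simplex `insert a s`,
  -- where the coordinates in `s` determine the point. Then `p` is injective on a chart, yet its
  -- image lies in a half-space with `p x₀` on the boundary, against invariance of domain.
  let p : (V → ℝ) → 𝔼 := fun x => ∑ v : s, x v • EuclideanSpace.single (ι v) (1 : ℝ)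
  have hp : Continuous p := by fun_prop
  have hpv : ∀ x (v : s), p x (ι v) = x v := fun x v => by
    simp [p, Pi.single_apply, ι.injective.eq_iff]
  have hpL : ∀ x, ∑ i, p x i = ∑ v ∈ s, x v := fun x => by
    have : ∀ i, p x i = ∑ v : s, x v * (if i = ι v then 1 else 0) := fun i => by
      simp [p, Pi.single_apply]
    simp only [this]
    rw [Finset.sum_comm]
    simp [Finset.sum_attach s x]
  set f : 𝔼 → 𝔼 := fun u => p (φ.symm u)
  have hf : ContinuousOn f (closedBall 0 R) :=
    hp.comp_continuousOn (continuous_subtype_val.comp_continuousOn (φ.continuousOn_symm.mono hRt))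
  have hx1 : ∀ x ∈ K.realization, (∀ v ∈ s, 0 < x v) → ∀ v, x v ≠ 0 → v ∈ insert a s := by
    rintro x ⟨hx, ρ, hρ, hxρ⟩ hxs v hv
    exact hstar ρ hρ (fun w hw => hxρ w (hxs w hw).ne') (hxρ v hv)
  have hfinj : InjOn f (closedBall 0 R) := by
    intro u hu u' hu' huu
    apply φ.symm.injOn (hRt hu) (hRt hu')
    have hxs := hRN u hu
    have hxs' := hRN u' hu'
    have heq : ∀ v ∈ s, (φ.symm u).1 v = (φ.symm u').1 v := fun v hv => by
      refine (hpv (φ.symm u).1 ⟨v, hv⟩).symm.trans (Eq.trans ?_ (hpv (φ.symm u').1 ⟨v, hv⟩))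
      exact congrArg (fun z : 𝔼 => z (ι ⟨v, hv⟩)) huu
    have h1 := hx1 _ (φ.symm u).2 hxs
    have h1' := hx1 _ (φ.symm u').2 hxs'
    ext v
    by_cases hv : v ∈ s
    · exact heq v hv
    by_cases hva : v = a
    · subst hva
      have h2 := sum_eq_one_of_subset (φ.symm u).2.1 h1
      have h2' := sum_eq_one_of_subset (φ.symm u').2.1 h1'
      rw [Finset.sum_insert hv] at h2 h2'
      rw [Finset.sum_congr rfl heq] at h2
      linarith
    · have hva' : v ∉ insert a s := by simp [hv, hva]
      rw [not_not.1 (mt (h1 v) hva'), not_not.1 (mt (h1' v) hva')]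
  have himg := image_closedBall_mem_nhds_of_injOn hR hf hfinj
  have hf0 : f 0 = p x₀ := by
    simp only [f]
    rw [← hφ0, φ.left_inv hφs]
  have hhalf : {y : 𝔼 | ∑ i, y i ≤ 1} ∈ 𝓝 (p x₀) := by
    rw [← hf0]
    refine mem_of_superset himg ?_
    rintro _ ⟨u, hu, rfl⟩
    simp only [f, mem_ofPred_eq, hpL]
    rw [← (φ.symm u).2.1.2]
    exact Finset.sum_le_sum_of_subset_of_nonneg (Finset.subset_univ _)
      fun v _ _ => (φ.symm u).2.1.1 v
  have hn : 0 < n := (nonempty_of_mem hs).card_pos.trans_le hsn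
  let γ : ℝ → 𝔼 := fun t => p x₀ + t • WithLp.toLp 2 fun _ => (1 : ℝ)
  have hγ : Continuous γ := by fun_prop
  have hev : ∀ᶠ t in 𝓝 (0 : ℝ), γ t ∈ {y : 𝔼 | ∑ i, y i ≤ 1} := by
    apply hγ.continuousAt.preimage_mem_nhds
    simpa [γ] using hhalf
  have hev' : ∀ᶠ t in 𝓝[>] (0 : ℝ), γ t ∈ {y : 𝔼 | ∑ i, y i ≤ 1} ∧ 0 < t :=
    (hev.filter_mono nhdsWithin_le_nhds).and self_mem_nhdsWithin
  obtain ⟨t, ht, ht0⟩ := hev'.exists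
  have h1 : ∑ i, p x₀ i = 1 := by rw [hpL, sum_eq_one_of_subset hx₀.1 hsup]
  have h2 : ∑ i, γ t i = 1 + n * t := by
    simp [γ, Finset.sum_add_distrib, h1]
  rw [mem_ofPred_eq, h2] at ht
  have : (0 : ℝ) < n * t := mul_pos (by exact_mod_cast hn) ht0
  linarith

/-- In a triangulated `n`-manifold with `τ` an `(n - 1)`-face of two `n`-simplices, the two
`n`-simplices contain every face that contains `τ`. -/
theorem subset_insert_or_subset_insert [DecidableEq V] [ChartedSpace 𝔼 K.realization]
    {τ : Finset V} (hτ : τ ∈ K) (hτn : τ.card = n) {a b : V} (ha : a ∉ τ) (hb : b ∉ τ)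
    (hab : a ≠ b) (haK : insert a τ ∈ K) (hbK : insert b τ ∈ K) {ρ : Finset V} (hρ : ρ ∈ K)
    (hτρ : τ ⊆ ρ) : ρ ⊆ insert a τ ∨ ρ ⊆ insert b τ := by
  have hn : 0 < n := hτn ▸ (nonempty_of_mem hτ).card_pos
  have hn' : (0 : ℝ) < n := by exact_mod_cast hn
  let ι : Fin n ≃ τ := (Fintype.equivFinOfCardEq (by simpa using hτn)).symm
  let L : 𝔼 → ℝ := fun u => ∑ i, u i
  have hLc : Continuous L := by fun_prop
  -- A chart-like map around the barycentre of `τ` onto the two simplices. `L` is the transverse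
  -- coordinate: the weight `|L u|` goes to `a` if `L u < 0` and to `b` if `L u > 0`, and the
  -- correction makes the weights on `τ` sum to `1 - |L u|`. Its image is a neighbourhood, so it
  -- meets the interior of every face containing `τ`.
  let j : 𝔼 → V → ℝ := fun u =>
    ∑ i, ((n : ℝ)⁻¹ + u i - (L u + |L u|) / n) • Pi.single (ι i : V) (1 : ℝ) +
      (max (-L u) 0 • Pi.single a (1 : ℝ) + max (L u) 0 • Pi.single b (1 : ℝ))
  have hj : Continuous j := by fun_prop
  have hιa : ∀ i, (ι i : V) ≠ a := fun i h => ha (h ▸ (ι i).2)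
  have hιb : ∀ i, (ι i : V) ≠ b := fun i h => hb (h ▸ (ι i).2)
  have hjι : ∀ u i, j u (ι i) = (n : ℝ)⁻¹ + u i - (L u + |L u|) / n := fun u i => by
    simp [j, Pi.single_apply, hιa, hιb]
  have hja : ∀ u, j u a = max (-L u) 0 := fun u => by
    simp [j, fun i => (hιa i).symm, hab]
  have hjb : ∀ u, j u b = max (L u) 0 := fun u => by
    simp [j, fun i => (hιb i).symm, hab.symm]
  have hjo : ∀ u v, v ∉ τ → v ≠ a → v ≠ b → j u v = 0 := fun u v hv hva hvb => by
    have : ∀ i, v ≠ ι i := fun i h => hv (h ▸ (ι i).2)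
    simp [j, this, hva, hvb]
  have hτι : ∀ v ∈ τ, ∃ i, (ι i : V) = v := fun v hv => ⟨ι.symm ⟨v, hv⟩, by simp⟩
  have hjsum : ∀ u, ∑ v, j u v = 1 := by
    intro u
    have h1 : ∑ v, j u v = ∑ i, ((n : ℝ)⁻¹ + u i - (L u + |L u|) / n) +
        (max (-L u) 0 + max (L u) 0) := by
      simp only [j, Pi.add_apply, Finset.sum_add_distrib, Finset.sum_apply, Pi.smul_apply,
        smul_eq_mul, ← Finset.mul_sum]
      rw [Finset.sum_comm]
      simp [← Finset.mul_sum]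
    rw [h1, Finset.sum_sub_distrib, Finset.sum_add_distrib]
    simp only [Finset.sum_const, Finset.card_univ, Fintype.card_fin, nsmul_eq_mul]
    rw [mul_inv_cancel₀ hn'.ne', mul_div_cancel₀ _ hn'.ne', show ∑ i, u i = L u from rfl]
    rcases le_total (L u) 0 with h | h
    · rw [abs_of_nonpos h, max_eq_left (by linarith), max_eq_right h]; ring
    · rw [abs_of_nonneg h, max_eq_right (by linarith), max_eq_left h]; ring
  have hjinj : Function.Injective j := by
    intro u u' h
    have hL : L u = L u' := by
      have h1 := hja u
      have h2 := hjb u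
      rw [h, hja] at h1
      rw [h, hjb] at h2
      have h3 : ∀ s : ℝ, max s 0 - max (-s) 0 = s := fun s => by
        rcases le_total s 0 with hs | hs
        · rw [max_eq_right hs, max_eq_left (by linarith)]; ring
        · rw [max_eq_left hs, max_eq_right (by linarith)]; ring
      rw [← h3 (L u), ← h3 (L u'), h1, h2]
    ext i
    have h1 := hjι u i
    rw [h, hjι, hL] at h1
    linarith
  have hj0 : ∀ i, j 0 (ι i) = (n : ℝ)⁻¹ := fun i => by simp [hjι, L]
  obtain ⟨R, hR, hRpos⟩ : ∃ R > 0, ∀ u ∈ closedBall (0 : 𝔼) R, ∀ i, 0 < j u (ι i) := by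
    have : ∀ᶠ u in 𝓝 (0 : 𝔼), ∀ i, 0 < j u (ι i) := by
      refine Filter.eventually_all.2 fun i => ?_
      have hc : Continuous fun u => j u (ι i) := (continuous_apply _).comp hj
      refine hc.continuousAt.eventually (lt_mem_nhds ?_)
      simp only [hj0]; positivity
    obtain ⟨R, hR, h⟩ := Metric.nhds_basis_closedBall.mem_iff.1 this
    exact ⟨R, hR, fun u hu => h hu⟩
  have hjY : MapsTo j (closedBall 0 R) K.realization := by
    intro u hu
    refine ⟨⟨fun v => ?_, hjsum u⟩, ?_⟩
    · by_cases hv : v ∈ τ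
      · obtain ⟨i, rfl⟩ := hτι v hv
        exact (hRpos u hu i).le
      by_cases hva : v = a
      · rw [hva, hja]; exact le_max_right _ _
      by_cases hvb : v = b
      · rw [hvb, hjb]; exact le_max_right _ _
      · rw [hjo u v hv hva hvb]
    · rcases le_total (L u) 0 with h | h
      · refine ⟨_, haK, fun v hv => ?_⟩
        by_contra hv'
        rw [Finset.mem_insert, not_or] at hv'
        by_cases hvb : v = b
        · rw [hvb, hjb, max_eq_right h] at hv; exact hv rfl
        · exact hv (hjo u v hv'.2 hv'.1 hvb)
      · refine ⟨_, hbK, fun v hv => ?_⟩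
        by_contra hv'
        rw [Finset.mem_insert, not_or] at hv'
        by_cases hva : v = a
        · rw [hva, hja, max_eq_right (by linarith)] at hv; exact hv rfl
        · exact hv (hjo u v hv'.2 hva hv'.1)
  have himg := image_closedBall_mem_nhdsWithin_of_injOn hR hj.continuousOn hjinj.injOn hjY
  have h0B : (0 : 𝔼) ∈ closedBall (0 : 𝔼) R := by simp [hR.le]
  have hj0τ : ∀ v, j 0 v ≠ 0 → v ∈ τ := fun v hv => by
    by_contra hvτ
    by_cases hva : v = a
    · rw [hva, hja] at hv; simp [L] at hv
    by_cases hvb : v = b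
    · rw [hvb, hjb] at hv; simp [L] at hv
    · exact hv (hjo 0 v hvτ hva hvb)
  obtain ⟨_, ⟨u, hu, rfl⟩, -, hpos, -⟩ := exists_mem_forall_pos hρ (hjY h0B).1
    (fun v hv => hτρ (hj0τ v hv)) himg
  by_contra! hcon
  simp only [Finset.not_subset, Finset.mem_insert, not_or] at hcon
  obtain ⟨⟨c, hcρ, hca, hcτ⟩, ⟨d, hdρ, hdb, hdτ⟩⟩ := hcon
  have hcb : c = b := by
    by_contra h; exact (hpos c hcρ).ne' (hjo u c hcτ hca h)
  have hda : d = a := by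
    by_contra h; exact (hpos d hdρ).ne' (hjo u d hdτ h hdb)
  have h1 := hpos c hcρ
  have h2 := hpos d hdρ
  rw [hcb, hjb, lt_max_iff] at h1
  rw [hda, hja, lt_max_iff] at h2
  simp only [lt_irrefl, or_false] at h1 h2
  linarith

/-- In a triangulated `n`-manifold, the star of a vertex is strongly connected. -/
theorem exists_le_card_inter [DecidableEq V] [ChartedSpace 𝔼 K.realization] {w : V}
    {A B : Set (Finset V)} (hP : A.Nonempty) (hQ : B.Nonempty)
    (hPK : ∀ σ ∈ A, σ ∈ K ∧ w ∈ σ) (hQK : ∀ σ ∈ B, σ ∈ K ∧ w ∈ σ)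
    (hPn : ∀ σ ∈ A, n ≤ σ.card) (hQn : ∀ σ ∈ B, n ≤ σ.card)
    (hcover : ∀ ρ ∈ K, w ∈ ρ → ∃ σ, ρ ⊆ σ ∧ (σ ∈ A ∨ σ ∈ B)) :
    ∃ σ ∈ A, ∃ σ' ∈ B, n ≤ (σ ∩ σ').card := by
  by_contra! hcard
  have hx₀ : Pi.single w (1 : ℝ) ∈ stdSimplex ℝ V := single_mem_stdSimplex ℝ w
  have hx₀w : ∀ {s : Finset V}, w ∈ s → ∀ v, (Pi.single w (1 : ℝ) : V → ℝ) v ≠ 0 → v ∈ s :=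
    fun {s} hw v hv => by
      by_contra h
      exact hv (Pi.single_eq_of_ne (by rintro rfl; exact h hw) _)
  obtain ⟨σP, hσP⟩ := hP
  obtain ⟨σQ, hσQ⟩ := hQ
  have hx₀K : Pi.single w (1 : ℝ) ∈ K.realization :=
    ⟨hx₀, σP, (hPK σP hσP).1, hx₀w (hPK σP hσP).2⟩
  set x₀ : K.realization := ⟨Pi.single w 1, hx₀K⟩
  obtain ⟨φ, hφs, hφ0⟩ := exists_openPartialHomeomorph_map_eq_zero (n := n) x₀
  have hN : {x : K.realization | 0 < x.1 w} ∈ 𝓝 x₀ := by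
    refine IsOpen.mem_nhds (isOpen_lt continuous_const
      ((continuous_apply w).comp continuous_subtype_val)) ?_
    simp [x₀]
  obtain ⟨R, hR, hRt, hRN⟩ := exists_closedBall_subset_chart hφs hφ0 hN
  let e : 𝔼 → V → ℝ := fun u => φ.symm u
  have he : ContinuousOn e (closedBall 0 R) :=
    continuous_subtype_val.comp_continuousOn (φ.continuousOn_symm.mono hRt)
  have hinj : InjOn e (closedBall 0 R) := fun u hu u' hu' h =>
    φ.symm.injOn (hRt hu) (hRt hu') (Subtype.ext h)
  let carrier : Set (Finset V) → Set (V → ℝ) := fun C => ⋃ σ ∈ C, {x | ∀ v ∉ σ, x v = 0}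
  have hclosed : ∀ C, IsClosed (carrier C) := fun C => by
    refine (toFinite C).isClosed_biUnion fun σ _ => ?_
    simp only [ofPred_forall]
    exact isClosed_iInter fun v => isClosed_iInter fun _ =>
      isClosed_eq (continuous_apply v) continuous_const
  have hmem : ∀ C x, x ∈ carrier C ↔ ∃ σ ∈ C, ∀ v ∉ σ, x v = 0 := fun C x => by simp [carrier]
  -- The directions of the face `s` at `w`, of dimension at most `s.card - 1`. If all intersections
  -- have fewer than `n` vertices, the closed sets carried by `A` and `B` cover the ball and meet
  -- only in codimension two or more.
  let S : Finset V → Submodule ℝ (V → ℝ) := fun s =>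
    Submodule.span ℝ ((s.erase w).image fun v => Pi.single v (1 : ℝ) - Pi.single w 1 :
      Finset (V → ℝ))
  have hinterior : ∀ σ ∈ K, w ∈ σ → ∃ y ∈ ball (0 : 𝔼) R, ∀ v ∈ σ, 0 < e y v := by
    intro σ hσ hw
    have hN' : φ.source ∩ φ ⁻¹' ball 0 R ∈ 𝓝 x₀ :=
      Filter.inter_mem (φ.open_source.mem_nhds hφs)
        ((φ.continuousAt hφs).preimage_mem_nhds (hφ0 ▸ ball_mem_nhds _ hR))
    obtain ⟨_, ⟨z, hz, rfl⟩, -, hpos, -⟩ := exists_mem_forall_pos hσ hx₀ (hx₀w hw)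
      (mem_nhds_subtype_iff_nhdsWithin.1 hN')
    refine ⟨φ z, hz.2, fun v hv => ?_⟩
    simp only [e, φ.left_inv hz.1]
    exact hpos v hv
  obtain ⟨y₀, hy₀, hy₀P⟩ := hinterior σP (hPK σP hσP).1 (hPK σP hσP).2
  obtain ⟨y₁, hy₁, hy₁Q⟩ := hinterior σQ (hQK σQ hσQ).1 (hQK σQ hσQ).2
  have hsub : ∀ {y} {σ σ' : Finset V}, (∀ v ∈ σ, 0 < e y v) → (∀ v ∉ σ', e y v = 0) → σ ⊆ σ' := by
    intro y σ σ' h h' v hv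
    by_contra hv'
    exact (h v hv).ne' (h' v hv')
  have hS : ∀ s : {s : Finset V // w ∈ s ∧ s.card < n}, Module.finrank ℝ (S s) + 1 < n := by
    rintro ⟨s, hw, hs⟩
    have h1 := (finrank_span_finset_le_card (R := ℝ)
      ((s.erase w).image fun v => (Pi.single v (1 : ℝ) - Pi.single w 1 : V → ℝ))).trans
      Finset.card_image_le
    rw [Finset.card_erase_of_mem hw] at h1
    have := Finset.card_pos.2 ⟨w, hw⟩
    simp only [S]
    unfold Set.finrank at h1
    omega
  rcases mem_or_mem_of_forall_inter_subset he hinj (hclosed A) (hclosed B) (fun y hy => by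
      obtain ⟨-, ρ, hρ, hyρ⟩ := (φ.symm y).2
      obtain ⟨σ, hρσ, hσ⟩ := hcover ρ hρ (hyρ w (hRN y hy).ne')
      have hyσ : ∀ v ∉ σ, e y v = 0 := fun v hv => by
        by_contra h
        exact hv (hρσ (hyρ v h))
      exact hσ.imp (fun h => (hmem _ _).2 ⟨σ, h, hyσ⟩) (fun h => (hmem _ _).2 ⟨σ, h, hyσ⟩))
    (fun _ => Pi.single w 1) (fun s : {s : Finset V // w ∈ s ∧ s.card < n} => S s) hS (by
      intro y hy hyA hyB
      obtain ⟨σ, hσ, hyσ⟩ := (hmem _ _).1 hyA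
      obtain ⟨σ', hσ', hyσ'⟩ := (hmem _ _).1 hyB
      refine ⟨⟨σ ∩ σ', Finset.mem_inter.2 ⟨(hPK σ hσ).2, (hQK σ' hσ').2⟩, hcard σ hσ σ' hσ'⟩, ?_⟩
      have hsupp : ∀ v, e y v ≠ 0 → v ∈ σ ∩ σ' := fun v hv =>
        Finset.mem_inter.2 ⟨by by_contra h; exact hv (hyσ v h), by by_contra h; exact hv (hyσ' v h)⟩
      have h1 : e y - Pi.single w 1 =
          ∑ v ∈ σ ∩ σ', e y v • (Pi.single v (1 : ℝ) - Pi.single w 1 : V → ℝ) := by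
        simp only [smul_sub, Finset.sum_sub_distrib, ← Finset.sum_smul]
        rw [sum_eq_one_of_subset (φ.symm y).2.1 hsupp, one_smul]
        congr 1
        ext u
        simp only [Finset.sum_apply, Pi.smul_apply, Pi.single_apply, smul_eq_mul, mul_ite, mul_one,
          mul_zero, Finset.sum_ite_eq]
        split_ifs with h
        · rfl
        · by_contra h'; exact h (hsupp u h')
      simp only [h1]
      refine Submodule.sum_mem _ fun v hv => Submodule.smul_mem _ _ ?_
      by_cases hvw : v = w
      · simp [hvw]
      · exact Submodule.subset_span
          (Finset.mem_coe.2 (Finset.mem_image_of_mem _ (Finset.mem_erase.2 ⟨hvw, hv⟩))))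
    hy₀ hy₁ with h | h
  · obtain ⟨σ', hσ', h'⟩ := (hmem _ _).1 h
    refine (hcard σP hσP σ' hσ').not_ge ?_
    rw [Finset.inter_eq_left.2 (hsub hy₀P h')]
    exact hPn σP hσP
  · obtain ⟨σ', hσ', h'⟩ := (hmem _ _).1 h
    refine (hcard σ' hσ' σQ hσQ).not_ge ?_
    rw [Finset.inter_eq_right.2 (hsub hy₁Q h')]
    exact hQn σQ hσQ

/-- A triangulated `n`-manifold is pure of dimension `n`. -/
theorem exists_superset_card_eq [ChartedSpace 𝔼 K.realization] (hn : 1 ≤ n) {s : Finset V}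
    (hs : s ∈ K) : ∃ σ ∈ K, s ⊆ σ ∧ σ.card = n + 1 := by
  classical
  have hle : ∀ ρ ∈ K, ρ.card ≤ n + 1 := by
    intro ρ hρ
    by_contra! hcard
    obtain ⟨τ, hτρ, hτ⟩ := Finset.exists_subset_card_eq (show n ≤ ρ.card by omega)
    have h2 : 1 < (ρ \ τ).card := by
      rw [Finset.card_sdiff_of_subset hτρ]; omega
    obtain ⟨a, ha, b, hb, hab⟩ := Finset.one_lt_card.1 h2
    rw [Finset.mem_sdiff] at ha hb
    have hτK : τ ∈ K := mem_of_subset_of_nonempty hρ hτρ (Finset.card_pos.1 (by omega))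
    have hins : ∀ x ∈ ρ, insert x τ ∈ K := fun x hx =>
      mem_of_subset_of_nonempty hρ (Finset.insert_subset hx hτρ) (Finset.insert_nonempty _ _)
    rcases subset_insert_or_subset_insert hτK hτ ha.2 hb.2 hab (hins a ha.1) (hins b hb.1) hρ hτρ
      with h | h <;>
    · have := Finset.card_le_card h
      have := Finset.card_insert_le a τ
      have := Finset.card_insert_le b τ
      omega
  obtain ⟨σ, hσ, hmax⟩ := (Set.toFinite {σ | σ ∈ K ∧ s ⊆ σ}).exists_le_maximal
    (show s ∈ {σ | σ ∈ K ∧ s ⊆ σ} from ⟨hs, subset_rfl⟩)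
  refine ⟨σ, hmax.prop.1, hmax.prop.2, le_antisymm (hle σ hmax.prop.1) ?_⟩
  by_contra! hlt
  obtain ⟨a, ha⟩ := nonempty_of_mem hmax.prop.1
  -- Taking `a` in `σ` makes `insert a σ = σ`, so the lemma contradicts maximality directly.
  obtain ⟨ρ, hρ, hσρ, hnot⟩ := exists_superset_not_subset_insert hmax.prop.1
    (by omega : σ.card ≤ n) a
  rw [Finset.insert_eq_of_mem ha] at hnot
  exact hnot (hmax.le_of_ge ⟨hρ, hmax.prop.2.trans hσρ⟩ hσρ)

/-- In a triangulated `n`-manifold, every `(n - 1)`-face is contained in exactly two `n`-faces. -/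
theorem ncard_superset_eq_two [ChartedSpace 𝔼 K.realization] {τ : Finset V}
    (hτ : τ ∈ K) (hτn : τ.card = n) : {σ | σ ∈ K ∧ τ ⊆ σ ∧ σ.card = n + 1}.ncard = 2 := by
  classical
  have hpure : ∀ x ∉ τ, ∀ ρ ∈ K, τ ⊆ ρ → x ∈ ρ → insert x τ ∈ K := fun x _ ρ hρ hτρ hx =>
    mem_of_subset_of_nonempty hρ (Finset.insert_subset hx hτρ) (Finset.insert_nonempty _ _)
  obtain ⟨t, ht⟩ := nonempty_of_mem hτ
  obtain ⟨ρ, hρ, hτρ, hnot⟩ := exists_superset_not_subset_insert hτ hτn.le t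
  rw [Finset.insert_eq_of_mem ht] at hnot
  obtain ⟨a, haρ, ha⟩ := Finset.not_subset.1 hnot
  -- A second use, now excluding the vertex `a` just found, yields a second coface.
  obtain ⟨ρ', hρ', hτρ', hnot'⟩ := exists_superset_not_subset_insert hτ hτn.le a
  obtain ⟨b, hbρ, hb⟩ := Finset.not_subset.1 hnot'
  rw [Finset.mem_insert, not_or] at hb
  have haK := hpure a ha ρ hρ hτρ haρ
  have hbK := hpure b hb.2 ρ' hρ' hτρ' hbρ
  rw [Set.ncard_eq_two]
  refine ⟨insert a τ, insert b τ, fun h => ?_, ?_⟩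
  · have : b ∈ insert a τ := h ▸ Finset.mem_insert_self b τ
    rw [Finset.mem_insert] at this
    exact this.elim hb.1 hb.2
  · ext σ
    simp only [mem_ofPred_eq, mem_insert_iff, mem_singleton_iff]
    constructor
    · rintro ⟨hσ, hτσ, hcard⟩
      refine (subset_insert_or_subset_insert hτ hτn ha hb.2 (Ne.symm hb.1) haK hbK hσ hτσ).imp
        (fun h => ?_) (fun h => ?_) <;>
      · refine Finset.eq_of_subset_of_card_le h ?_
        rw [hcard, ← hτn]
        exact Finset.card_insert_le _ _
    · rintro (rfl | rfl)
      · exact ⟨haK, Finset.subset_insert _ _, by rw [Finset.card_insert_of_notMem ha, hτn]⟩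
      · exact ⟨hbK, Finset.subset_insert _ _, by rw [Finset.card_insert_of_notMem hb.2, hτn]⟩

/-- In a triangulated `n`-manifold, a function of the `n`-simplices at a vertex that takes equal
values on adjacent simplices is constant. -/
theorem eq_of_forall_adjacent_eq [DecidableEq V] [ChartedSpace 𝔼 K.realization] (hn : 1 ≤ n)
    {w : V} {α : Type*} (F : Finset V → α)
    (hF : ∀ σ ∈ K, ∀ σ' ∈ K, w ∈ σ → w ∈ σ' → σ.card = n + 1 → σ'.card = n + 1 →
      (σ ∩ σ').card = n → F σ = F σ')
    {σ σ' : Finset V} (hσ : σ ∈ K) (hσ' : σ' ∈ K) (hw : w ∈ σ) (hw' : w ∈ σ')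
    (hc : σ.card = n + 1) (hc' : σ'.card = n + 1) : F σ = F σ' := by
  by_contra hne
  -- Split the `n`-simplices at `w` by whether `F` agrees with `F σ`; strong connectivity yields an
  -- adjacent pair across the split.
  obtain ⟨ρ, ⟨⟨h1, h2, h3⟩, h4⟩, ρ', ⟨⟨h1', h2', h3'⟩, h4'⟩, h⟩ :=
    exists_le_card_inter (K := K) (n := n) (w := w)
    (A := {ρ | (ρ ∈ K ∧ w ∈ ρ ∧ ρ.card = n + 1) ∧ F ρ = F σ})
    (B := {ρ | (ρ ∈ K ∧ w ∈ ρ ∧ ρ.card = n + 1) ∧ F ρ ≠ F σ})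
    ⟨σ, ⟨hσ, hw, hc⟩, rfl⟩ ⟨σ', ⟨hσ', hw', hc'⟩, Ne.symm hne⟩ (fun ρ h => ⟨h.1.1, h.1.2.1⟩)
    (fun ρ h => ⟨h.1.1, h.1.2.1⟩) (fun ρ h => h.1.2.2 ▸ n.le_succ) (fun ρ h => h.1.2.2 ▸ n.le_succ)
    (fun ρ hρ hwρ => by
      obtain ⟨μ, hμ, hρμ, hμc⟩ := exists_superset_card_eq hn hρ
      exact ⟨μ, hρμ, (em _).imp (fun h => ⟨⟨hμ, hρμ hwρ, hμc⟩, h⟩)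
        (fun h => ⟨⟨hμ, hρμ hwρ, hμc⟩, h⟩)⟩)
  refine h4' ((hF ρ' h1' ρ h1 h2' h2 h3' h3 ?_).trans h4)
  rw [Finset.inter_comm]
  refine le_antisymm ?_ h
  by_contra! hlt
  have h5 : ρ ∩ ρ' = ρ := Finset.eq_of_subset_of_card_le Finset.inter_subset_left (by omega)
  have h6 : ρ ∩ ρ' = ρ' := Finset.eq_of_subset_of_card_le Finset.inter_subset_right (by omega)
  exact h4' (by rw [← h6, h5, h4])

end AbstractSimplicialComplex

end Realization

/-! ### Carving a graph into small balls with few cut edges. -/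

section Carving

variable {S T : Type*} {inc : T → S → Prop}

/-- `Near inc r σ₀ σ` says that `σ` is within `r` steps of `σ₀`, where `σ` and `σ'` are adjacent if
they are incident to a common element of `T`. -/
def Near (inc : T → S → Prop) : ℕ → S → S → Prop
  | 0, σ₀, σ => σ = σ₀
  | r + 1, σ₀, σ' => Near inc r σ₀ σ' ∨ ∃ σ τ, Near inc r σ₀ σ ∧ inc τ σ ∧ inc τ σ'

theorem Near.mono {r r' : ℕ} (h : r ≤ r') {σ₀ σ : S} (hσ : Near inc r σ₀ σ) :
    Near inc r' σ₀ σ := by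
  induction h with
  | refl => exact hσ
  | step _ ih => exact Or.inl ih

variable [Fintype S] [Fintype T]

open Classical in
/-- A finite graph contains, around each point, a ball with few edges leaving it. -/
theorem exists_near_small_boundary {D : ℕ}
    (hD : ∀ σ, (Finset.univ.filter fun τ => inc τ σ).card ≤ D) (hD0 : 0 < D) {θ : ℝ} (hθ : 0 ≤ θ)
    {L : ℕ} (hL : (Fintype.card S : ℝ) < (1 + θ / D) ^ L) (A : Finset S) {σ₀ : S} (hσ₀ : σ₀ ∈ A) :
    ∃ B ⊆ A, σ₀ ∈ B ∧ (∀ σ ∈ B, Near inc L σ₀ σ) ∧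
      ((Finset.univ.filter fun τ => ∃ σ ∈ B, ∃ σ' ∈ A \ B, inc τ σ ∧ inc τ σ').card : ℝ) ≤
        θ * B.card := by
  by_contra! hcon
  have hD0' : (0 : ℝ) < D := by exact_mod_cast hD0
  -- If every ball cuts more than `θ * B.card` elements of `T`, each of which has an endpoint
  -- outside, then with at most `D` per outside point the ball grows by a factor `1 + θ / D` per
  -- step and outgrows `S` after `L` steps.
  have key : ∀ r ≤ L, ∃ B ⊆ A, σ₀ ∈ B ∧ (∀ σ ∈ B, Near inc r σ₀ σ) ∧
      (1 + θ / D) ^ r ≤ (B.card : ℝ) := by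
    intro r
    induction r with
    | zero =>
      intro _
      exact ⟨{σ₀}, by simpa using hσ₀, by simp, by simp [Near], by simp⟩
    | succ r ih =>
      intro hr
      obtain ⟨B, hBA, hσB, hnear, hcard⟩ := ih (by omega)
      set E := Finset.univ.filter fun τ => ∃ σ ∈ B, ∃ σ' ∈ A \ B, inc τ σ ∧ inc τ σ'
      set N := (A \ B).filter fun σ' => ∃ σ ∈ B, ∃ τ, inc τ σ ∧ inc τ σ'
      have hE : θ * B.card < E.card := hcon B hBA hσB fun σ hσ => (hnear σ hσ).mono (by omega)
      have hEN : E ⊆ N.biUnion fun σ' => Finset.univ.filter fun τ => inc τ σ' := by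
        intro τ hτ
        simp only [E, Finset.mem_filter, Finset.mem_univ, true_and] at hτ
        obtain ⟨σ, hσ, σ', hσ', h1, h2⟩ := hτ
        simp only [Finset.mem_biUnion, N, Finset.mem_filter, Finset.mem_univ, true_and]
        exact ⟨σ', ⟨hσ', σ, hσ, τ, h1, h2⟩, h2⟩
      have hEc : E.card ≤ N.card * D :=
        (Finset.card_le_card hEN).trans (Finset.card_biUnion_le_card_mul _ _ _ fun σ _ => hD σ)
      have hEc' : (E.card : ℝ) ≤ N.card * D := by exact_mod_cast hEc
      have hdisj : Disjoint B N := Finset.disjoint_left.2 fun σ hσ hσN =>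
        (Finset.mem_sdiff.1 (Finset.mem_filter.1 hσN).1).2 hσ
      refine ⟨B ∪ N, Finset.union_subset hBA ((Finset.filter_subset _ _).trans
        Finset.sdiff_subset), Finset.mem_union_left _ hσB, ?_, ?_⟩
      · intro σ hσ
        rcases Finset.mem_union.1 hσ with h | h
        · exact Or.inl (hnear σ h)
        · obtain ⟨-, σ', hσ', τ, h1, h2⟩ := Finset.mem_filter.1 h
          exact Or.inr ⟨σ', τ, hnear σ' hσ', h1, h2⟩
      · rw [Finset.card_union_of_disjoint hdisj, pow_succ]
        push_cast
        have h1 : θ / D * B.card ≤ N.card := by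
          rw [div_mul_eq_mul_div, div_le_iff₀ hD0']
          linarith
        have h2 : 0 ≤ 1 + θ / D := by positivity
        calc (1 + θ / D) ^ r * (1 + θ / D) ≤ B.card * (1 + θ / D) := by gcongr
          _ ≤ _ := by linarith
  obtain ⟨B, -, -, -, hB⟩ := key L le_rfl
  have : (B.card : ℝ) ≤ Fintype.card S := by exact_mod_cast Finset.card_le_univ B
  linarith

open Classical in
/-- If a `ℤ/2`-valued function on incident pairs is trivial on all balls of radius `L`, then it can
be trivialized globally away from few elements of `T`. -/
theorem exists_potential_ncard_le {D : ℕ}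
    (hD : ∀ σ, (Finset.univ.filter fun τ => inc τ σ).card ≤ D) (hD0 : 0 < D) {θ : ℝ} (hθ : 0 ≤ θ)
    {L : ℕ} (hL : (Fintype.card S : ℝ) < (1 + θ / D) ^ L) (γ : T → S → ZMod 2)
    (hγ : ∀ σ₀, ∃ c : S → ZMod 2, ∀ σ σ', Near inc L σ₀ σ → Near inc L σ₀ σ' →
      ∀ τ, inc τ σ → inc τ σ' → γ τ σ + c σ = γ τ σ' + c σ') :
    ∃ c : S → ZMod 2, ({τ | ∃ σ σ', inc τ σ ∧ inc τ σ' ∧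
      γ τ σ + c σ ≠ γ τ σ' + c σ'}.ncard : ℝ) ≤ θ * Fintype.card S := by
  -- Induct by carving a ball `B` off `A` and gluing its potential to one for `A \ B`. New defects
  -- occur only on elements cut by `B`, and these are charged to `B.card`.
  suffices H : ∀ A : Finset S, ∃ c : S → ZMod 2,
      ((Finset.univ.filter fun τ => ∃ σ ∈ A, ∃ σ' ∈ A, inc τ σ ∧ inc τ σ' ∧
        γ τ σ + c σ ≠ γ τ σ' + c σ').card : ℝ) ≤ θ * A.card by
    obtain ⟨c, hc⟩ := H Finset.univ
    refine ⟨c, ?_⟩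
    rw [← Set.ncard_coe_finset] at hc
    simpa using hc
  intro A
  induction A using Finset.strongInduction with
  | H A ih =>
    rcases A.eq_empty_or_nonempty with rfl | ⟨σ₀, hσ₀⟩
    · exact ⟨0, by simp⟩
    obtain ⟨B, hBA, hσB, hnear, hcut⟩ := exists_near_small_boundary hD hD0 hθ hL A hσ₀
    obtain ⟨c₁, hc₁⟩ := hγ σ₀
    obtain ⟨c₂, hc₂⟩ := ih (A \ B) (Finset.sdiff_ssubset hBA ⟨σ₀, hσB⟩)
    set E := Finset.univ.filter fun τ => ∃ σ ∈ B, ∃ σ' ∈ A \ B, inc τ σ ∧ inc τ σ'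
    set E₂ := Finset.univ.filter fun τ => ∃ σ ∈ A \ B, ∃ σ' ∈ A \ B, inc τ σ ∧ inc τ σ' ∧
        γ τ σ + c₂ σ ≠ γ τ σ' + c₂ σ'
    refine ⟨fun σ => if σ ∈ B then c₁ σ else c₂ σ, ?_⟩
    have hsub : (Finset.univ.filter fun τ => ∃ σ ∈ A, ∃ σ' ∈ A, inc τ σ ∧ inc τ σ' ∧
        γ τ σ + (if σ ∈ B then c₁ σ else c₂ σ) ≠ γ τ σ' + (if σ' ∈ B then c₁ σ' else c₂ σ')) ⊆
        E ∪ E₂ := by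
      intro τ hτ
      simp only [Finset.mem_filter, Finset.mem_univ, true_and] at hτ
      obtain ⟨σ, hσ, σ', hσ', h1, h2, hne⟩ := hτ
      simp only [Finset.mem_union, E, E₂, Finset.mem_filter, Finset.mem_univ, true_and,
        Finset.mem_sdiff]
      by_cases hB : σ ∈ B <;> by_cases hB' : σ' ∈ B
      · simp only [hB, hB', if_true] at hne
        exact absurd (hc₁ σ σ' (hnear σ hB) (hnear σ' hB') τ h1 h2) hne
      · exact Or.inl ⟨σ, hB, σ', ⟨hσ', hB'⟩, h1, h2⟩
      · exact Or.inl ⟨σ', hB', σ, ⟨hσ, hB⟩, h2, h1⟩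
      · simp only [hB, hB', if_false] at hne
        exact Or.inr ⟨σ, ⟨hσ, hB⟩, σ', ⟨hσ', hB'⟩, h1, h2, hne⟩
    have h1 : (A.card : ℝ) = B.card + (A \ B).card := by
      rw [← Finset.card_sdiff_add_card_eq_card hBA]
      push_cast
      ring
    calc _ ≤ ((E ∪ E₂).card : ℝ) := by exact_mod_cast Finset.card_le_card hsub
      _ ≤ E.card + E₂.card := by exact_mod_cast Finset.card_union_le _ _
      _ ≤ θ * A.card := by rw [h1, mul_add]; exact add_le_add hcut hc₂

end Carving

/-! ### Mod 2 chains, their pairing with cochains, and the systole. -/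

section Chains

namespace AbstractSimplicialComplex

variable {V : Type*} [Fintype V] {K : AbstractSimplicialComplex V}

open Classical in
/-- The extension of a chain by zero to all finite sets. -/
noncomputable def extend {k : ℕ} (c : K.Chain k) (s : Finset V) : ZMod 2 :=
  if h : s ∈ K ∧ s.card = k + 1 then c ⟨s, h⟩ else 0

omit [Fintype V] in
theorem extend_coe {k : ℕ} (c : K.Chain k) (s : K.Simplices k) : extend c s.1 = c s := by
  simp [extend, s.2]
  rfl

open Classical in
theorem boundary_apply {k : ℕ} (c : K.Chain (k + 1)) (τ : K.Simplices k) :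
    K.boundary k c τ = ∑ σ with τ.1 ⊆ σ.1, c σ := by
  simp [boundary, incidence, Matrix.mulVec, dotProduct, Finset.sum_filter]

open Classical in
theorem coboundary_apply {k : ℕ} (c : K.Chain k) (σ : K.Simplices (k + 1)) :
    K.coboundary k c σ = ∑ τ with τ.1 ⊆ σ.1, c τ := by
  simp [coboundary, incidence, Matrix.vecMul, dotProduct, Finset.sum_filter]

open Classical in
/-- The sum over the facets of a simplex as a sum over its vertices. -/
theorem sum_facets [DecidableEq V] {k : ℕ} {M : Type*} [AddCommMonoid M] (f : Finset V → M)
    (σ : K.Simplices (k + 1)) :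
    ∑ τ : K.Simplices k with τ.1 ⊆ σ.1, f τ.1 = ∑ x ∈ σ.1, f (σ.1.erase x) := by
  have hc := σ.2.2
  symm
  refine Finset.sum_bij (fun x hx => (⟨σ.1.erase x, mem_of_subset_of_nonempty σ.2.1
      (Finset.erase_subset _ _) (Finset.card_pos.1 (by rw [Finset.card_erase_of_mem hx]; omega)),
      by rw [Finset.card_erase_of_mem hx]; omega⟩ : K.Simplices k)) ?_ ?_ ?_ ?_
  · intro x hx
    exact Finset.mem_filter.2 ⟨Finset.mem_univ _, Finset.erase_subset _ _⟩
  · intro x hx y hy hxy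
    have := congrArg Subtype.val hxy
    exact Finset.erase_injOn _ hx hy this
  · intro τ hτ
    have hτσ : τ.1 ⊆ σ.1 := (Finset.mem_filter.1 hτ).2
    obtain ⟨x, hx⟩ : ∃ x, σ.1 \ τ.1 = {x} := by
      rw [← Finset.card_eq_one, Finset.card_sdiff_of_subset hτσ, hc, τ.2.2]; omega
    have hx' : x ∈ σ.1 \ τ.1 := by simp [hx]
    refine ⟨x, (Finset.mem_sdiff.1 hx').1, Subtype.ext ?_⟩
    change σ.1.erase x = τ.1
    rw [Finset.erase_eq, ← hx, Finset.sdiff_sdiff_eq_self hτσ]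
  · intro x hx
    rfl

theorem coboundary_eq_sum_erase [DecidableEq V] {k : ℕ} (c : K.Chain k)
    (σ : K.Simplices (k + 1)) : K.coboundary k c σ = ∑ x ∈ σ.1, extend c (σ.1.erase x) := by
  rw [coboundary_apply, ← sum_facets]
  exact Finset.sum_congr (by congr) fun τ _ => (extend_coe c τ).symm

theorem boundary_boundary {k : ℕ} (c : K.Chain (k + 2)) :
    K.boundary k (K.boundary (k + 1) c) = 0 := by
  classical
  ext ρ
  rw [boundary_apply]
  simp only [boundary_apply]
  rw [Finset.sum_comm' (t' := Finset.univ) (s' := fun σ => Finset.univ.filter fun τ =>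
    ρ.1 ⊆ τ.1 ∧ τ.1 ⊆ σ.1) (by simp)]
  refine Finset.sum_eq_zero fun σ _ => ?_
  rw [Finset.sum_const, nsmul_eq_mul]
  -- A simplex between `ρ` and `σ` arises by deleting one of the two vertices of `σ \ ρ`, so there
  -- are none or two.
  have h : (((Finset.univ.filter fun τ : K.Simplices (k + 1) =>
      ρ.1 ⊆ τ.1 ∧ τ.1 ⊆ σ.1).card : ℕ) : ZMod 2) = 0 := by
    have h1 := sum_facets (fun s => if ρ.1 ⊆ s then (1 : ZMod 2) else 0) σ
    rw [← Finset.sum_filter, Finset.filter_filter, Finset.sum_const, nsmul_eq_mul, mul_one] at h1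
    simp only [and_comm (a := ρ.1 ⊆ _)]
    rw [h1]
    by_cases hρσ : ρ.1 ⊆ σ.1
    · have h2 : ∀ x ∈ σ.1, (if ρ.1 ⊆ σ.1.erase x then (1 : ZMod 2) else 0) =
          if x ∈ σ.1 \ ρ.1 then 1 else 0 := fun x hx => by
        simp [Finset.subset_erase, hρσ, hx]
      rw [Finset.sum_congr rfl h2, Finset.sum_boole]
      have : σ.1.filter (· ∈ σ.1 \ ρ.1) = σ.1 \ ρ.1 := by ext; simp
      rw [this, Finset.card_sdiff_of_subset hρσ, σ.2.2, ρ.2.2, show k + 2 + 1 - (k + 1) = 2 by omega]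
      rfl
    · refine Finset.sum_eq_zero fun x _ => if_neg fun h => hρσ (h.trans (Finset.erase_subset _ _))
  rw [h, zero_mul]

theorem dotProduct_boundary {k : ℕ} (α : K.Chain k) (c : K.Chain (k + 1)) :
    α ⬝ᵥ K.boundary k c = K.coboundary k α ⬝ᵥ c := by
  simp only [boundary, coboundary, Matrix.mulVecLin_apply, Matrix.dotProduct_mulVec,
    Matrix.mulVec_transpose]

theorem homologyClass_eq_zero_iff {k : ℕ} (z : K.cycles k) :
    K.homologyClass k z = 0 ↔ ∃ c, K.boundary k c = z := by
  rw [homologyClass, Submodule.mkQ_apply, Submodule.Quotient.mk_eq_zero]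
  rfl

theorem homologyClass_eq_zero_of_size_lt {k : ℕ} (z : K.cycles k)
    (hz : (K.size (z : K.Chain k) : ℕ∞) < K.systole k) : K.homologyClass k z = 0 := by
  by_contra h
  exact hz.not_ge (iInf₂_le z h)

/-- A cocycle vanishes on cycles that are shorter than the systole. -/
theorem dotProduct_eq_zero_of_size_lt {k : ℕ} {α : K.Chain k} (hα : α ∈ K.cocycles k)
    {z : K.Chain k} (hz : z ∈ K.cycles k) (hlt : (K.size z : ℕ∞) < K.systole k) :
    α ⬝ᵥ z = 0 := by
  obtain ⟨c, hc⟩ := (homologyClass_eq_zero_iff ⟨z, hz⟩).1 (homologyClass_eq_zero_of_size_lt _ hlt)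
  rw [← show K.boundary k c = z from hc, dotProduct_boundary, LinearMap.mem_ker.1 hα,
    zero_dotProduct]

theorem size_add_le {k : ℕ} (z z' : K.Chain k) : K.size (z + z') ≤ K.size z + K.size z' :=
  (Set.ncard_le_ncard (Function.support_add z z') (Set.toFinite _)).trans (Set.ncard_union_le _ _)

theorem size_eq_zero_iff {k : ℕ} {z : K.Chain k} : K.size z = 0 ↔ z = 0 := by
  rw [size, Set.ncard_eq_zero (Set.toFinite _), Function.support_eq_empty_iff]

end AbstractSimplicialComplex

end Chains

/-! ### The Poincaré dual of a 1-cocycle. -/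

section DualChains

namespace AbstractSimplicialComplex

variable {V : Type*} [Fintype V] {K : AbstractSimplicialComplex V}

/-- A face as a simplex. -/
def mkSimplex {V : Type*} {K : AbstractSimplicialComplex V} {k : ℕ} (s : Finset V) (hs : s ∈ K)
    (hc : s.card = k + 1) : K.Simplices k :=
  ⟨s, hs, hc⟩

omit [Fintype V] in
theorem chain_add_self {k : ℕ} (z : K.Chain k) : z + z = 0 :=
  funext fun σ => CharTwo.add_self_eq_zero (z σ)

open Classical in
/-- The value of a 1-cochain on the edge between two vertices, and zero if there is no edge. -/
noncomputable def edgeValue (α : K.Chain 1) (u v : V) : ZMod 2 := extend α {u, v}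

omit [Fintype V] in
theorem edgeValue_self (α : K.Chain 1) (u : V) : edgeValue α u u = 0 := by
  simp [edgeValue, extend]

omit [Fintype V] in
theorem edgeValue_comm (α : K.Chain 1) (u v : V) : edgeValue α u v = edgeValue α v u := by
  classical
  rw [edgeValue, edgeValue, Finset.pair_comm]

theorem edgeValue_add_edgeValue {α : K.Chain 1} (hα : α ∈ K.cocycles 1) {s : Finset V} (hs : s ∈ K)
    {u v w : V} (hu : u ∈ s) (hv : v ∈ s) (hw : w ∈ s) :
    edgeValue α u v + edgeValue α v w = edgeValue α u w := by
  classical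
  by_cases huv : u = v
  · rw [huv, edgeValue_self, zero_add]
  by_cases hvw : v = w
  · rw [hvw, edgeValue_self, add_zero]
  by_cases huw : u = w
  · rw [← huw, edgeValue_comm α v u, edgeValue_self, CharTwo.add_self_eq_zero]
  have hσ : ({u, v, w} : Finset V) ∈ K := mem_of_subset_of_nonempty hs
    (by simp [Finset.insert_subset_iff, hu, hv, hw]) (Finset.insert_nonempty _ _)
  have hc : ({u, v, w} : Finset V).card = 1 + 1 + 1 := by
    rw [Finset.card_insert_of_notMem (by simp [huv, huw]), Finset.card_pair hvw]
  have h := congrFun (LinearMap.mem_ker.1 hα) (mkSimplex _ hσ hc : K.Simplices 2)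
  rw [coboundary_eq_sum_erase] at h
  have h1 : ({u, v, w} : Finset V).erase u = {v, w} := by ext x; simp; grind
  have h2 : ({u, v, w} : Finset V).erase v = {u, w} := by ext x; simp; grind
  have h3 : ({u, v, w} : Finset V).erase w = {u, v} := by ext x; simp; grind
  change ∑ x ∈ ({u, v, w} : Finset V), extend α (({u, v, w} : Finset V).erase x) = 0 at h
  rw [Finset.sum_insert (by simp [huv, huw]), Finset.sum_pair hvw, h1, h2, h3] at h
  change edgeValue α v w + (edgeValue α u w + edgeValue α u v) = 0 at h
  rw [← CharTwo.add_eq_zero]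
  linear_combination h

open Classical in
/-- The 0-chain of a vertex. -/
noncomputable def vertexChain (K : AbstractSimplicialComplex V) (u : V) : K.Chain 0 :=
  fun τ => if u ∈ τ.1 then 1 else 0

open Classical in
/-- The 1-chain of the edge between two vertices, and zero if there is no edge. -/
noncomputable def edgeChain (K : AbstractSimplicialComplex V) (u v : V) : K.Chain 1 :=
  fun e => if e.1 = {u, v} then 1 else 0

theorem boundary_edgeChain {u v : V} {s : Finset V} (hs : s ∈ K) (hu : u ∈ s) (hv : v ∈ s) :
    K.boundary 0 (edgeChain K u v) = vertexChain K u + vertexChain K v := by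
  classical
  by_cases huv : u = v
  · subst huv
    have : edgeChain K u u = 0 := by
      ext e
      refine if_neg fun h => ?_
      have := e.2.2
      rw [h] at this
      simp at this
    rw [this, map_zero, chain_add_self]
  have hσ : ({u, v} : Finset V) ∈ K := mem_of_subset_of_nonempty hs
    (by simp [Finset.insert_subset_iff, hu, hv]) (Finset.insert_nonempty _ _)
  ext τ
  obtain ⟨x, hx⟩ := Finset.card_eq_one.1 τ.2.2
  obtain ⟨E, hE⟩ : ∃ E : K.Simplices 1, E.1 = {u, v} :=
    ⟨mkSimplex _ hσ (Finset.card_pair huv), rfl⟩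
  have hτE : τ.1 ⊆ E.1 ↔ x = u ∨ x = v := by rw [hx, hE]; simp
  have hvtx : ∀ y, vertexChain K y τ = if x = y then 1 else 0 := fun y => by
    simp only [vertexChain, hx, Finset.mem_singleton, eq_comm]
  rw [boundary_apply, Finset.sum_filter, Finset.sum_eq_single E]
  · rw [show edgeChain K u v E = 1 from if_pos hE, Pi.add_apply, hvtx, hvtx]
    by_cases h1 : x = u
    · have h2 : x ≠ v := h1 ▸ huv
      simp [hτE, h1, huv]
    · by_cases h2 : x = v
      · simp [hτE, h2, Ne.symm huv]
      · simp [hτE, h1, h2]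
  · intro e _ he
    have : edgeChain K u v e = 0 := if_neg fun h => he (Subtype.ext (h.trans hE.symm))
    simp [this]
  · simp

theorem size_edgeChain_le (u v : V) : K.size (edgeChain K u v) ≤ 1 := by
  classical
  refine (Set.ncard_le_one_iff (Set.toFinite _)).2 fun {e e'} he he' => ?_
  have h : ∀ {e : K.Simplices 1}, e ∈ Function.support (edgeChain K u v) → e.1 = {u, v} :=
    fun {e} he => by
      by_contra h
      exact he (if_neg h)
  exact Subtype.ext ((h he).trans (h he').symm)

theorem dotProduct_edgeChain (α : K.Chain 1) (u v : V) :
    α ⬝ᵥ edgeChain K u v = edgeValue α u v := by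
  classical
  simp only [dotProduct, edgeChain, mul_ite, mul_one, mul_zero]
  by_cases h : ({u, v} : Finset V) ∈ K ∧ ({u, v} : Finset V).card = 1 + 1
  · rw [Finset.sum_eq_single (mkSimplex _ h.1 h.2)]
    · rw [edgeValue, extend, dif_pos h]
      exact if_pos rfl
    · intro e _ he
      exact if_neg fun h' => he (Subtype.ext h')
    · simp
  · rw [edgeValue, extend, dif_neg h]
    exact Finset.sum_eq_zero fun e _ => if_neg fun h' => h (by rw [← h']; exact e.2)

/-- A vertex of a simplex. -/
noncomputable def base {k : ℕ} (σ : K.Simplices k) : V := (nonempty_of_mem σ.2.1).choose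

omit [Fintype V] in
theorem base_mem {k : ℕ} (σ : K.Simplices k) : base σ ∈ σ.1 := (nonempty_of_mem σ.2.1).choose_spec

open Classical in
/-- The chain Poincaré dual to the 1-cochain `α`, plus the boundary of `c`. -/
noncomputable def dualChain {m : ℕ} (α : K.Chain 1) (c : K.Chain (m + 1)) : K.Chain m := fun τ =>
  ∑ σ : K.Simplices (m + 1) with τ.1 ⊆ σ.1, (edgeValue α (base σ) (base τ) + c σ)

theorem dualChain_add {m : ℕ} (α : K.Chain 1) (c d : K.Chain (m + 1)) :
    dualChain α (c + d) = dualChain α c + K.boundary m d := by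
  ext τ
  simp only [dualChain, Pi.add_apply, boundary_apply, ← Finset.sum_add_distrib, add_assoc]

section Manifold

variable {m : ℕ} [ChartedSpace (EuclideanSpace ℝ (Fin (m + 1))) K.realization]

open Classical in
theorem card_cofaces (τ : K.Simplices m) :
    (Finset.univ.filter fun σ : K.Simplices (m + 1) => τ.1 ⊆ σ.1).card = 2 := by
  rw [← ncard_superset_eq_two (n := m + 1) τ.2.1 τ.2.2, ← Set.ncard_coe_finset]
  refine Set.ncard_congr (fun σ _ => σ.1) ?_ ?_ ?_
  · intro σ hσ
    exact ⟨σ.2.1, by simpa using hσ, σ.2.2⟩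
  · intro σ σ' _ _ h
    exact Subtype.ext h
  · rintro s ⟨hs, hτs, hc⟩
    exact ⟨mkSimplex s hs hc, Finset.mem_coe.2 (Finset.mem_filter.2 ⟨Finset.mem_univ _, hτs⟩), rfl⟩

open Classical in
theorem sum_cofaces_const (τ : K.Simplices m) (x : ZMod 2) :
    ∑ σ : K.Simplices (m + 1) with τ.1 ⊆ σ.1, x = 0 := by
  rw [Finset.sum_const, card_cofaces, two_nsmul, CharTwo.add_self_eq_zero]

open Classical in
/-- The dual chain does not depend on the choice of vertices in the simplices of codimension 1. -/
theorem dualChain_apply_eq_of_mem {α : K.Chain 1} (hα : α ∈ K.cocycles 1) (c : K.Chain (m + 1))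
    {τ : K.Simplices m} {w : V} (hw : w ∈ τ.1) :
    dualChain α c τ =
      ∑ σ : K.Simplices (m + 1) with τ.1 ⊆ σ.1, (edgeValue α (base σ) w + c σ) := by
  -- Because `τ` has exactly two cofaces, a constant may be added to each summand; the cocycle
  -- condition then moves the endpoint from `base τ` to `w`.
  rw [← add_zero (dualChain α c τ), ← sum_cofaces_const τ (edgeValue α (base τ) w), dualChain,
    ← Finset.sum_add_distrib]
  refine Finset.sum_congr rfl fun σ hσ => ?_
  have hτσ := (Finset.mem_filter.1 hσ).2
  rw [← edgeValue_add_edgeValue hα σ.2.1 (base_mem σ) (hτσ (base_mem τ)) (hτσ hw)]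
  ring

/-- At a face `ρ`, the vertex `base ρ` can serve as the endpoint for every `τ` containing `ρ`. There
the dual chain agrees with the boundary of one top-dimensional chain, so its boundary vanishes at
`ρ` by `boundary_boundary`. -/
theorem dualChain_mem_cycles {α : K.Chain 1} (hα : α ∈ K.cocycles 1) (c : K.Chain (m + 1)) :
    dualChain α c ∈ K.cycles m := by
  classical
  cases m with
  | zero => exact Submodule.mem_top
  | succ k =>
    refine LinearMap.mem_ker.2 ?_
    ext ρ
    have h := congrFun (boundary_boundary fun σ => edgeValue α (base σ) (base ρ) + c σ) ρ
    rw [boundary_apply] at h ⊢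
    rw [← h]
    refine Finset.sum_congr rfl fun τ hτ => ?_
    rw [boundary_apply]
    exact dualChain_apply_eq_of_mem hα c ((Finset.mem_filter.1 hτ).2 (base_mem ρ))

theorem dualChain_apply_eq_zero {α : K.Chain 1} {c : K.Chain (m + 1)} {τ : K.Simplices m}
    (h : ∀ σ σ' : K.Simplices (m + 1), τ.1 ⊆ σ.1 → τ.1 ⊆ σ'.1 →
      edgeValue α (base σ) (base τ) + c σ = edgeValue α (base σ') (base τ) + c σ') :
    dualChain α c τ = 0 := by
  classical
  obtain ⟨σ, σ', -, hF⟩ := Finset.card_eq_two.1 (card_cofaces τ)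
  have hσ : τ.1 ⊆ σ.1 := by
    have := Finset.mem_insert_self σ {σ'}
    rw [← hF] at this
    exact (Finset.mem_filter.1 this).2
  rw [dualChain, ← sum_cofaces_const τ (edgeValue α (base σ) (base τ) + c σ)]
  exact Finset.sum_congr rfl fun ρ hρ => h ρ σ (Finset.mem_filter.1 hρ).2 hσ

/-- Poincaré duality is injective: if the dual chain vanishes, the cocycle is a coboundary. -/
theorem mem_coboundaries_of_dualChain_eq_zero {α : K.Chain 1} (hα : α ∈ K.cocycles 1)
    {c : K.Chain (m + 1)} (h0 : dualChain α c = 0) : α ∈ K.coboundaries 1 := by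
  classical
  have hadj : ∀ (τ : K.Simplices m) (σ σ' : K.Simplices (m + 1)), τ.1 ⊆ σ.1 → τ.1 ⊆ σ'.1 →
      ∀ w ∈ τ.1, edgeValue α (base σ) w + c σ = edgeValue α (base σ') w + c σ' := by
    intro τ σ σ' hσ hσ' w hw
    obtain ⟨ρ, ρ', hne, hF⟩ := Finset.card_eq_two.1 (card_cofaces τ)
    have h1 := dualChain_apply_eq_of_mem hα c hw
    rw [h0, hF, Finset.sum_pair hne, Pi.zero_apply, eq_comm, CharTwo.add_eq_zero] at h1
    have hmem : ∀ μ : K.Simplices (m + 1), τ.1 ⊆ μ.1 → μ = ρ ∨ μ = ρ' := fun μ hμ => by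
      have : μ ∈ ({ρ, ρ'} : Finset (K.Simplices (m + 1))) := by
        rw [← hF]
        exact Finset.mem_filter.2 ⟨Finset.mem_univ _, hμ⟩
      simpa using this
    rcases hmem σ hσ with rfl | rfl <;> rcases hmem σ' hσ' with rfl | rfl
    · rfl
    · exact h1
    · exact h1.symm
    · rfl
  -- A vanishing dual chain makes this value agree across adjacent simplices at `w`, so strong
  -- connectivity of the star makes it a function of `w` alone. That function is the 0-cochain `f`
  -- with coboundary `α`.
  have hstar : ∀ (w : V) (σ σ' : K.Simplices (m + 1)), w ∈ σ.1 → w ∈ σ'.1 →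
      edgeValue α (base σ) w + c σ = edgeValue α (base σ') w + c σ' := by
    intro w σ σ' hσ hσ'
    let F : Finset V → ZMod 2 := fun s => if h : s ∈ K ∧ s.card = m + 1 + 1 then
      edgeValue α (base (mkSimplex s h.1 h.2 : K.Simplices (m + 1))) w + c (mkSimplex s h.1 h.2)
      else 0
    have hF : ∀ σ : K.Simplices (m + 1), F σ.1 = edgeValue α (base σ) w + c σ := fun σ =>
      dif_pos σ.2
    rw [← hF, ← hF]
    refine eq_of_forall_adjacent_eq (K := K) (n := m + 1) (by omega) F ?_ σ.2.1 σ'.2.1 hσ hσ'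
      σ.2.2 σ'.2.2
    intro s hs s' hs' hws hws' hc hc' hcard
    have h := hadj (mkSimplex (s ∩ s') (mem_of_subset_of_nonempty hs Finset.inter_subset_left
      ⟨w, Finset.mem_inter.2 ⟨hws, hws'⟩⟩) hcard) (mkSimplex s hs hc) (mkSimplex s' hs' hc')
      Finset.inter_subset_left Finset.inter_subset_right w (Finset.mem_inter.2 ⟨hws, hws'⟩)
    rw [← hF, ← hF] at h
    exact h
  have hex : ∀ τ : K.Simplices 0, ∃ σ : K.Simplices (m + 1), τ.1 ⊆ σ.1 := fun τ => by
    obtain ⟨s, hs, hτs, hc⟩ := exists_superset_card_eq (n := m + 1) (by omega) τ.2.1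
    exact ⟨mkSimplex s hs hc, hτs⟩
  choose star hstar_sub using hex
  let f : K.Chain 0 := fun τ => edgeValue α (base (star τ)) (base τ) + c (star τ)
  have hf : ∀ (x : V) (σ : K.Simplices (m + 1)), x ∈ σ.1 →
      extend f {x} = edgeValue α (base σ) x + c σ := by
    intro x σ hx
    have hxK : ({x} : Finset V) ∈ K := K.singleton_mem x
    let τ : K.Simplices 0 := mkSimplex {x} hxK rfl
    have hb : base τ = x := Finset.mem_singleton.1 (base_mem τ)
    rw [extend, dif_pos ⟨hxK, rfl⟩]
    change edgeValue α (base (star τ)) (base τ) + c (star τ) = _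
    rw [hb]
    exact hstar x _ _ (hstar_sub τ (Finset.mem_singleton_self x)) hx
  refine ⟨f, ?_⟩
  ext e
  obtain ⟨u, v, huv, he⟩ := Finset.card_eq_two.1 e.2.2
  obtain ⟨s, hs, hes, hc⟩ := exists_superset_card_eq (n := m + 1) (by omega) e.2.1
  rw [he] at hes
  have hu : u ∈ s := hes (by simp)
  have hv : v ∈ s := hes (by simp)
  let σ : K.Simplices (m + 1) := mkSimplex s hs hc
  have h1 : ({u, v} : Finset V).erase u = {v} := by ext x; simp; grind
  have h2 : ({u, v} : Finset V).erase v = {u} := by ext x; simp; grind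
  have h3 : edgeValue α u v = α e := by
    rw [edgeValue, ← extend_coe α e, he]
  rw [coboundary_eq_sum_erase, he, Finset.sum_pair huv, h1, h2, hf v σ hv, hf u σ hu, ← h3,
    ← edgeValue_add_edgeValue hα hs hu (base_mem σ) hv, edgeValue_comm α u]
  linear_combination (CharTwo.add_self_eq_zero (c σ))

/-- A chain `d` bounded by the dual cycle can be absorbed into `c`, giving a dual chain that is zero
and forcing `α` to be a coboundary. -/
theorem homologyClass_dualChain_ne_zero {α : K.Chain 1} (hα : α ∈ K.cocycles 1)
    (hα' : α ∉ K.coboundaries 1) (c : K.Chain (m + 1)) :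
    K.homologyClass m ⟨dualChain α c, dualChain_mem_cycles hα c⟩ ≠ 0 := by
  rw [Ne, homologyClass_eq_zero_iff]
  rintro ⟨d, hd⟩
  refine hα' (mem_coboundaries_of_dualChain_eq_zero hα (c := c + d) ?_)
  rw [dualChain_add, hd, chain_add_self]

end Manifold

end AbstractSimplicialComplex

end DualChains

/-! ### From the carving to the systolic inequality. -/

section Systoles

namespace AbstractSimplicialComplex

variable {V : Type*} [Fintype V] {K : AbstractSimplicialComplex V} {m : ℕ}

/-- Simplices that are near each other in the dual graph are joined by short paths. -/
theorem exists_chain_of_near {r : ℕ} {σ₀ σ : K.Simplices (m + 1)}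
    (h : Near (fun (τ : K.Simplices m) (σ : K.Simplices (m + 1)) => τ.1 ⊆ σ.1) r σ₀ σ) :
    ∃ β : K.Chain 1, K.size β ≤ 2 * r ∧
      K.boundary 0 β = vertexChain K (base σ₀) + vertexChain K (base σ) := by
  induction r generalizing σ with
  | zero =>
    obtain rfl : σ = σ₀ := h
    exact ⟨0, by rw [size_eq_zero_iff.2 rfl], by rw [map_zero, chain_add_self]⟩
  | succ r ih =>
    rcases h with h | ⟨σ', τ, h, hσ', hσ⟩
    · obtain ⟨β, hβ, hβ'⟩ := ih h
      exact ⟨β, by omega, hβ'⟩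
    · obtain ⟨β, hβ, hβ'⟩ := ih h
      -- Each step in the dual graph costs two edges, through the base vertex of the common face.
      refine ⟨β + (edgeChain K (base σ') (base τ) + edgeChain K (base τ) (base σ)), ?_, ?_⟩
      · have h1 := size_add_le β (edgeChain K (base σ') (base τ) + edgeChain K (base τ) (base σ))
        have h2 := size_add_le (edgeChain K (base σ') (base τ)) (edgeChain K (base τ) (base σ))
        have h3 := size_edgeChain_le (K := K) (base σ') (base τ)
        have h4 := size_edgeChain_le (K := K) (base τ) (base σ)
        omega
      · rw [map_add, map_add, hβ', boundary_edgeChain σ'.2.1 (base_mem σ') (hσ' (base_mem τ)),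
          boundary_edgeChain σ.2.1 (hσ (base_mem τ)) (base_mem σ)]
        linear_combination (exp := 1) chain_add_self (vertexChain K (base σ')) +
          chain_add_self (vertexChain K (base τ))

/-- On balls in the dual graph that are smaller than the systole, the dual chain of a cocycle is a
boundary. -/
theorem exists_potential_of_near {α : K.Chain 1} (hα : α ∈ K.cocycles 1) {L : ℕ}
    (hL : ((4 * L + 2 : ℕ) : ℕ∞) < K.systole 1) (σ₀ : K.Simplices (m + 1)) :
    ∃ c : K.Chain (m + 1), ∀ σ σ' : K.Simplices (m + 1),
      Near (fun (τ : K.Simplices m) (σ : K.Simplices (m + 1)) => τ.1 ⊆ σ.1) L σ₀ σ →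
      Near (fun (τ : K.Simplices m) (σ : K.Simplices (m + 1)) => τ.1 ⊆ σ.1) L σ₀ σ' →
      ∀ τ : K.Simplices m, τ.1 ⊆ σ.1 → τ.1 ⊆ σ'.1 →
      edgeValue α (base σ) (base τ) + c σ = edgeValue α (base σ') (base τ) + c σ' := by
  classical
  have hβ : ∀ σ : K.Simplices (m + 1), ∃ β : K.Chain 1,
      Near (fun (τ : K.Simplices m) (σ : K.Simplices (m + 1)) => τ.1 ⊆ σ.1) L σ₀ σ →
      K.size β ≤ 2 * L ∧
        K.boundary 0 β = vertexChain K (base σ₀) + vertexChain K (base σ) := fun σ => by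
    by_cases h : Near (fun (τ : K.Simplices m) (σ : K.Simplices (m + 1)) => τ.1 ⊆ σ.1) L σ₀ σ
    · obtain ⟨β, hβ⟩ := exists_chain_of_near h
      exact ⟨β, fun _ => hβ⟩
    · exact ⟨0, fun h' => absurd h' h⟩
  choose β hβ using hβ
  -- The potential integrates `α` along a path from `σ₀`. Two such paths closed up through `base τ`
  -- form a cycle of at most `2L + 2L + 2` edges, below the systole, so `α` vanishes on it.
  refine ⟨fun σ => α ⬝ᵥ β σ, fun σ σ' hσ hσ' τ hτ hτ' => ?_⟩
  obtain ⟨h1, h1'⟩ := hβ σ hσ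
  obtain ⟨h2, h2'⟩ := hβ σ' hσ'
  set e := edgeChain K (base σ) (base τ)
  set e' := edgeChain K (base τ) (base σ')
  have hcyc : β σ + β σ' + (e + e') ∈ K.cycles 1 := by
    refine LinearMap.mem_ker.2 ?_
    rw [map_add, map_add, map_add, h1', h2',
      boundary_edgeChain σ.2.1 (base_mem σ) (hτ (base_mem τ)),
      boundary_edgeChain σ'.2.1 (hτ' (base_mem τ)) (base_mem σ')]
    linear_combination (exp := 1) chain_add_self (vertexChain K (base σ₀)) +
      chain_add_self (vertexChain K (base σ)) + chain_add_self (vertexChain K (base σ')) +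
      chain_add_self (vertexChain K (base τ))
  have hsize : K.size (β σ + β σ' + (e + e')) ≤ 4 * L + 2 := by
    have h3 := size_add_le (β σ + β σ') (e + e')
    have h4 := size_add_le (β σ) (β σ')
    have h5 := size_add_le e e'
    have h6 : K.size e ≤ 1 := size_edgeChain_le _ _
    have h7 : K.size e' ≤ 1 := size_edgeChain_le _ _
    omega
  have h0 := dotProduct_eq_zero_of_size_lt hα hcyc (lt_of_le_of_lt (by exact_mod_cast hsize) hL)
  rw [dotProduct_add, dotProduct_add, dotProduct_add, dotProduct_edgeChain, dotProduct_edgeChain,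
    edgeValue_comm α (base τ)] at h0
  rw [← CharTwo.add_eq_zero]
  linear_combination h0

open Classical in
theorem card_facets_le (σ : K.Simplices (m + 1)) :
    (Finset.univ.filter fun τ : K.Simplices m => τ.1 ⊆ σ.1).card ≤ m + 2 := by
  have h := sum_facets (fun _ => 1) σ
  rw [← Finset.card_eq_sum_ones, Finset.sum_const, smul_eq_mul, mul_one, σ.2.2] at h
  exact h.le

theorem size_pos_of_homologyClass_ne_zero {k : ℕ} {z : K.cycles k} (hz : K.homologyClass k z ≠ 0) :
    0 < K.size (z : K.Chain k) := by
  refine Nat.pos_of_ne_zero fun h => hz ?_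
  rw [show z = 0 from Subtype.ext (size_eq_zero_iff.1 h), map_zero]

section Manifold

variable [ChartedSpace (EuclideanSpace ℝ (Fin (m + 1))) K.realization]

/-- The codimension-1 systole of a manifold is bounded by the number of its facets. -/
theorem exists_homologyClass_ne_zero_size_le {α : K.Chain 1} (hα : α ∈ K.cocycles 1)
    (hα' : α ∉ K.coboundaries 1) :
    ∃ z : K.cycles m, K.homologyClass m z ≠ 0 ∧
      K.size (z : K.Chain m) ≤ (m + 2) * K.vol (m + 1) := by
  classical
  refine ⟨_, homologyClass_dualChain_ne_zero hα hα' 0, ?_⟩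
  have h1 : (Finset.univ : Finset (K.Simplices m)) ⊆
      (Finset.univ : Finset (K.Simplices (m + 1))).biUnion
        fun σ => Finset.univ.filter fun τ : K.Simplices m => τ.1 ⊆ σ.1 := by
    intro τ _
    obtain ⟨s, hs, hτs, hc⟩ := exists_superset_card_eq (n := m + 1) (by omega) τ.2.1
    exact Finset.mem_biUnion.2 ⟨mkSimplex s hs hc, Finset.mem_univ _,
      Finset.mem_filter.2 ⟨Finset.mem_univ _, hτs⟩⟩
  have h2 := (Finset.card_le_card h1).trans
    (Finset.card_biUnion_le_card_mul _ _ _ fun σ _ => card_facets_le σ)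
  rw [mul_comm]
  refine le_trans ?_ h2
  rw [size, ← Set.ncard_coe_finset]
  exact Set.ncard_le_ncard (by simp) (Set.toFinite _)

/-- If the systole is large, there is a small nontrivial cycle of codimension 1. -/
theorem exists_homologyClass_ne_zero_size_le_of_lt_systole {α : K.Chain 1} (hα : α ∈ K.cocycles 1)
    (hα' : α ∉ K.coboundaries 1) {L : ℕ} (hL : ((4 * L + 2 : ℕ) : ℕ∞) < K.systole 1) {θ : ℝ}
    (hθ : 0 ≤ θ) (hθL : (K.vol (m + 1) : ℝ) < (1 + θ / (m + 2 : ℕ)) ^ L) :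
    ∃ z : K.cycles m, K.homologyClass m z ≠ 0 ∧
      (K.size (z : K.Chain m) : ℝ) ≤ θ * K.vol (m + 1) := by
  classical
  obtain ⟨c, hc⟩ := exists_potential_ncard_le
    (inc := fun (τ : K.Simplices m) (σ : K.Simplices (m + 1)) => τ.1 ⊆ σ.1)
    (fun σ => by convert card_facets_le σ) (by omega) hθ hθL
    (fun τ σ => edgeValue α (base σ) (base τ))
    (exists_potential_of_near hα hL)
  refine ⟨_, homologyClass_dualChain_ne_zero hα hα' c, le_trans ?_ hc⟩
  refine Nat.cast_le.2 (Set.ncard_le_ncard (fun τ hτ => ?_) (Set.toFinite _))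
  by_contra hcon
  refine hτ (dualChain_apply_eq_zero fun σ σ' hσ hσ' => ?_)
  by_contra hne
  exact hcon ⟨σ, σ', hσ, hσ', hne⟩

/-- The choice is `θ = 2 (m + 2) ℓ / L` with `ℓ = log (vol + 1)`. Since `exp x ≤ 1 + 2 x` on `[0,
1]`, which is where `ℓ ≤ L` enters, `(1 + 2 ℓ / L) ^ L ≥ exp ℓ = vol + 1`. -/
theorem exists_homologyClass_ne_zero_size_le_log {α : K.Chain 1} (hα : α ∈ K.cocycles 1)
    (hα' : α ∉ K.coboundaries 1) {L : ℕ} (hL : ((4 * L + 2 : ℕ) : ℕ∞) < K.systole 1)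
    (hL0 : 0 < L) (hlog : Real.log (K.vol (m + 1) + 1) ≤ L) :
    ∃ z : K.cycles m, K.homologyClass m z ≠ 0 ∧ (K.size (z : K.Chain m) : ℝ) ≤
      2 * (m + 2) * Real.log (K.vol (m + 1) + 1) / L * K.vol (m + 1) := by
  set ℓ := Real.log (K.vol (m + 1) + 1)
  have hvol : (0 : ℝ) ≤ K.vol (m + 1) := Nat.cast_nonneg _
  have hℓ : 0 ≤ ℓ := Real.log_nonneg (by linarith)
  have hL0' : (0 : ℝ) < L := by exact_mod_cast hL0
  refine exists_homologyClass_ne_zero_size_le_of_lt_systole hα hα' hL (by positivity) ?_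
  have h1 : 1 + 2 * (m + 2) * ℓ / L / ((m + 2 : ℕ) : ℝ) = 1 + 2 * (ℓ / L) := by
    push_cast; field_simp
  rw [h1]
  have h2 : Real.exp (ℓ / L) ≤ 1 + 2 * (ℓ / L) := by
    have h3 : 0 ≤ ℓ / L := by positivity
    have h4 := Real.abs_exp_sub_one_le (x := ℓ / L)
      (by rw [abs_of_nonneg h3]; exact (div_le_one hL0').2 hlog)
    rw [abs_of_nonneg h3] at h4
    linarith [le_abs_self (Real.exp (ℓ / L) - 1)]
  calc (K.vol (m + 1) : ℝ) < K.vol (m + 1) + 1 := by linarith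
    _ = Real.exp (ℓ / L) ^ L := by
        rw [← Real.exp_nat_mul, mul_div_cancel₀ _ hL0'.ne', Real.exp_log (by linarith)]
    _ ≤ _ := by gcongr

theorem one_le_vol {α : K.Chain 1} (hα : α ∈ K.cocycles 1) (hα' : α ∉ K.coboundaries 1) :
    1 ≤ K.vol (m + 1) := by
  obtain ⟨z, hz, hle⟩ := exists_homologyClass_ne_zero_size_le (m := m) hα hα'
  by_contra! h
  have h1 := size_pos_of_homologyClass_ne_zero hz
  rw [Nat.lt_one_iff.1 h] at hle
  omega

/-- With an infinite systole `L` is unrestricted, and a large `L` would give a nontrivial cycle with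
fewer than one simplex. -/
theorem systole_one_ne_top (m : ℕ) [ChartedSpace (EuclideanSpace ℝ (Fin (m + 1))) K.realization]
    {α : K.Chain 1} (hα : α ∈ K.cocycles 1) (hα' : α ∉ K.coboundaries 1) :
    K.systole 1 ≠ ⊤ := by
  intro htop
  set ℓ := Real.log (K.vol (m + 1) + 1)
  have hvol : (0 : ℝ) ≤ K.vol (m + 1) := Nat.cast_nonneg _
  have hℓ : 0 ≤ ℓ := Real.log_nonneg (by linarith)
  obtain ⟨L, hL⟩ := exists_nat_gt (ℓ + 2 * (m + 2) * ℓ * K.vol (m + 1))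
  have hp : 0 ≤ 2 * (m + 2) * ℓ * K.vol (m + 1) := by positivity
  have hL0 : (0 : ℝ) < L := by linarith
  obtain ⟨z, hz, hle⟩ := exists_homologyClass_ne_zero_size_le_log (m := m) hα hα' (L := L)
    (htop ▸ ENat.natCast_lt_top _) (by exact_mod_cast hL0) (show ℓ ≤ L by linarith)
  have h1 : (1 : ℝ) ≤ K.size (z : K.Chain m) := by
    exact_mod_cast size_pos_of_homologyClass_ne_zero hz
  have h2 : 2 * (m + 2) * ℓ / L * K.vol (m + 1) < 1 := by
    rw [div_mul_eq_mul_div, div_lt_one hL0]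
    linarith
  linarith

/-- The systolic inequality, with a logarithmic factor. -/
theorem exists_size_mul_le_log {α : K.Chain 1} (hα : α ∈ K.cocycles 1)
    (hα' : α ∉ K.coboundaries 1) :
    ∃ s N : ℕ, K.systole 1 = s ∧ K.systole m ≤ N ∧
      (s * N : ℝ) ≤ 20 * (m + 2) * Real.log (K.vol (m + 1) + 1) * K.vol (m + 1) := by
  obtain ⟨s, hs⟩ := ENat.ne_top_iff_exists.1 (systole_one_ne_top m hα hα')
  set ℓ := Real.log (K.vol (m + 1) + 1) with hℓdef
  have hvol : (1 : ℝ) ≤ K.vol (m + 1) := by exact_mod_cast one_le_vol hα hα'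
  have hℓ : 1 / 2 < ℓ := by
    have h1 : Real.log 2 ≤ ℓ := Real.log_le_log (by norm_num) (by linarith)
    linarith [Real.log_two_gt_d9]
  -- The largest `L` with `4 * L + 2 < s`. For `s < 3` truncation gives 0 and the second case
  -- applies.
  set L := (s - 3) / 4
  have hsL : (s : ℝ) ≤ 4 * L + 6 := by exact_mod_cast (by omega : s ≤ 4 * L + 6)
  -- In the first case `s ≤ 4 L + 6 ≤ 10 L`. In the second `L ≤ ℓ`, and `ℓ > 1 / 2` gives `s ≤ 4 ℓ +
  -- 6 ≤ 20 ℓ`, so the count of all codimension-1 simplices suffices.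
  by_cases hcase : 0 < L ∧ ℓ ≤ L
  · obtain ⟨hL0, hLℓ⟩ := hcase
    obtain ⟨z, hz, hle⟩ := exists_homologyClass_ne_zero_size_le_log (m := m) hα hα' (L := L)
      (by rw [← hs]; exact_mod_cast (by omega : 4 * L + 2 < s)) hL0 hLℓ
    refine ⟨s, _, hs.symm, iInf₂_le z hz, ?_⟩
    have hL1 : (1 : ℝ) ≤ L := by exact_mod_cast hL0
    calc (s * K.size (z : K.Chain m) : ℝ)
        ≤ (10 * L) * (2 * (m + 2) * ℓ / L * K.vol (m + 1)) := by
          gcongr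
          linarith
      _ = 20 * (m + 2) * ℓ * K.vol (m + 1) := by field_simp; ring
  · obtain ⟨z, hz, hle⟩ := exists_homologyClass_ne_zero_size_le (m := m) hα hα'
    refine ⟨s, _, hs.symm, iInf₂_le z hz, ?_⟩
    have hLℓ : (L : ℝ) ≤ ℓ := by
      by_cases hL0 : 0 < L
      · exact (not_le.1 fun h => hcase ⟨hL0, h⟩).le
      · rw [Nat.eq_zero_of_not_pos hL0, Nat.cast_zero]; linarith
    have hle' : (K.size (z : K.Chain m) : ℝ) ≤ (m + 2) * K.vol (m + 1) := by exact_mod_cast hle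
    calc (s * K.size (z : K.Chain m) : ℝ) ≤ (20 * ℓ) * ((m + 2) * K.vol (m + 1)) := by
          gcongr
          linarith
      _ = 20 * (m + 2) * ℓ * K.vol (m + 1) := by ring

end Manifold

end AbstractSimplicialComplex

/-- Combines `log y ≤ y ^ ε / ε` at `y = x + 1` with `x + 1 ≤ 2 x`. -/
theorem log_add_one_mul_le_rpow {ε : ℝ} (hε : 0 < ε) {x : ℝ} (hx : 1 ≤ x) :
    Real.log (x + 1) * x ≤ 2 ^ ε / ε * x ^ (1 + ε) := by
  have h1 : Real.log (x + 1) ≤ (x + 1) ^ ε / ε := Real.log_le_rpow_div (by linarith) hε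
  have h2 : (x + 1) ^ ε ≤ (2 * x) ^ ε := by
    apply Real.rpow_le_rpow <;> linarith
  rw [Real.mul_rpow (by norm_num) (by linarith)] at h2
  rw [Real.rpow_add (by linarith), Real.rpow_one]
  calc Real.log (x + 1) * x ≤ (2 ^ ε * x ^ ε / ε) * x := by
        gcongr
        exact h1.trans (by gcongr)
    _ = _ := by ring

end Systoles

theorem theorem1 (n : ℕ) (hn : 1 ≤ n) (ε : ℝ) (hε : 0 < ε) :
    ∃ c : ℝ, 0 < c ∧
      ∀ (V : Type*) [Fintype V] (M : AbstractSimplicialComplex V),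
        M.IsClosedManifold n → Nontrivial (M.Cohomology 1) →
          ((M.systole 1 * M.systole (n - 1) : ℕ∞) : ℝ≥0∞) ≤
            ENNReal.ofReal (c * (M.vol n : ℝ) ^ (1 + ε)) := by
  obtain ⟨m, rfl⟩ : ∃ m, n = m + 1 := ⟨n - 1, by omega⟩
  -- The constant of the logarithmic inequality times the cost of replacing the logarithm by a
  -- power.
  refine ⟨20 * (m + 2) * (2 ^ ε / ε), by positivity, ?_⟩
  intro V _ M ⟨_⟩ hM
  obtain ⟨α, hα, hα'⟩ : ∃ α ∈ M.cocycles 1, α ∉ M.coboundaries 1 := by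
    by_contra! h
    obtain ⟨x, hx⟩ := exists_ne (0 : M.Cohomology 1)
    obtain ⟨⟨α, hα⟩, rfl⟩ := Submodule.Quotient.mk_surjective _ x
    exact hx ((Submodule.Quotient.mk_eq_zero _).2 (h α hα))
  obtain ⟨s, N, hs, hN, hle⟩ := AbstractSimplicialComplex.exists_size_mul_le_log (m := m) hα hα'
  have hvol : (1 : ℝ) ≤ M.vol (m + 1) := by
    exact_mod_cast AbstractSimplicialComplex.one_le_vol hα hα'
  calc ((M.systole 1 * M.systole m : ℕ∞) : ℝ≥0∞) ≤ ((s * N : ℕ∞) : ℝ≥0∞) := by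
        rw [hs]
        gcongr
    _ = ENNReal.ofReal (s * N) := by
        rw [ENNReal.ofReal_mul (Nat.cast_nonneg _), ENNReal.ofReal_natCast, ENNReal.ofReal_natCast]
        simp
    _ ≤ _ := by
        refine ENNReal.ofReal_le_ofReal (hle.trans ?_)
        rw [mul_assoc _ (Real.log _), mul_assoc _ (2 ^ ε / ε)]
        exact mul_le_mul_of_nonneg_left (log_add_one_mul_le_rpow hε hvol) (by positivity)
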